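/- Let $X\subset\mathbb{RP}^n$ be an irreducible nondegenerate real projective variety (not contained in a hyperplane) whose real points are Zariski dense in $X$. Let $X_{\mathbb C}\subset\mathbb{CP}^n$ be its complexification, i.e. the complex variety defined by the same equations, and let $\hat X\subset\mathbb R^{n+1}$ and $\hat X_{\mathbb C}\subset\mathbb C^{n+1}$ be the affine cones. The $X$-rank of a vector $v\in\mathbb R^{n+1}$ is the least $r$ such that $v=x_1+\dots+x_r$ with all $x_i\in\hat X$; the $X_{\mathbb C}$-rank of a vector in $\mathbb C^{n+1}$ is defined in the same way with $\hat X_{\mathbb C}$. An integer $r$ is a typical rank of $X$ if the set of vectors of $X$-rank $r$ contains a nonempty subset of $\mathbb R^{n+1}$ that is open in the Euclidean topology, and a generic rank of $X_{\mathbb C}$ if the set of vectors of $X_{\mathbb C}$-rank $r$ contains a nonempty Zariski open subset of $\mathbb C^{n+1}$. Then: 1. $X_{\mathbb C}$ has exactly one generic rank $r_{\mathrm{gen}}$, and $X$ has a smallest typical rank $r_0$, and $$r_0=r_{\mathrm{gen}}.$$ 2. There is a nonzero homogeneous polynomial $f\in\mathbb R[x_0,\dots,x_n]$ of positive degree that vanishes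 at all vectors of $\mathbb C^{n+1}$ of $X_{\mathbb C}$-rank less than $r_{\mathrm{gen}}$ and at all vectors of $\mathbb R^{n+1}$ of $X$-rank less than $r_{\mathrm{gen}}$. 3. The image $\{x_1+\dots+x_{r_{\mathrm{gen}}} : x_i\in\hat X\}\subset\mathbb R^{n+1}$ of the sum map is a semialgebraic set (a finite union of sets, each defined by finitely many real polynomial equations $f=0$ and inequalities $g>0$), and it contains a nonempty Euclidean open subset of $\mathbb R^{n+1}$. -/

import Mathlib

/-- A projective variety `X ⊆ ℙⁿ` over a field `F`, given by its homogeneous radical ideal in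
`F[x₀, …, xₙ]`.  (As usual this is the closed subscheme, not merely its set of `F`-points.) -/
structure ProjVariety (F : Type*) [Field F] (n : ℕ) where
  /-- the ideal generated by all forms vanishing on `X` -/
  ideal : Ideal (MvPolynomial (Fin (n + 1)) F)
  /-- the ideal is homogeneous -/
  homogeneous : ∀ f ∈ ideal, ∀ d : ℕ, MvPolynomial.homogeneousComponent d f ∈ ideal
  radical : ideal.IsRadical

namespace ProjVariety

/-- `X` is irreducible: its ideal is prime, and `X` is nonempty, that is, the ideal does not
contain the irrelevant ideal `(x₀, …, xₙ)`. -/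
def IsIrreducible {F : Type*} [Field F] {n : ℕ} (X : ProjVariety F n) : Prop :=
  X.ideal.IsPrime ∧ ∃ i : Fin (n + 1), MvPolynomial.X i ∉ X.ideal

/-- `X` is nondegenerate: it is not contained in a hyperplane, that is, no nonzero linear form
vanishes on `X`. -/
def IsNondegenerate {F : Type*} [Field F] {n : ℕ} (X : ProjVariety F n) : Prop :=
  ∀ l : MvPolynomial (Fin (n + 1)) F, l.IsHomogeneous 1 → l ≠ 0 → l ∉ X.ideal

/-- The set of `K`-points of the affine cone `X̂` over `X`, for a field extension `K / F`: the
common zeros in `K^{n+1}` of the equations of `X`.  For `F = ℝ`, taking `K = ℝ` gives the affine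
cone over the real variety `X`, and `K = ℂ` gives the affine cone over its complexification
`X_ℂ`, the complex variety defined by the same equations. -/
def cone {F : Type*} [Field F] {n : ℕ} (X : ProjVariety F n) (K : Type*) [Field K] [Algebra F K] :
    Set (Fin (n + 1) → K) :=
  MvPolynomial.zeroLocus K X.ideal

/-- The `F`-rational points of `X` are Zariski dense in `X`, that is, `X` is the Zariski closure of
its set of `F`-points: each form that vanishes at all `F`-points of `X` vanishes on `X`. -/
def RationalPointsDense {F : Type*} [Field F] {n : ℕ} (X : ProjVariety F n) : Prop :=
  ∀ (d : ℕ) (f : MvPolynomial (Fin (n + 1)) F), f.IsHomogeneous d →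
    (∀ v ∈ X.cone F, v ≠ 0 → MvPolynomial.eval v f = 0) → f ∈ X.ideal

end ProjVariety

/-- The image of the sum map `(x₁, …, x_r) ↦ x₁ + ⋯ + x_r` on `S ^ r`. -/
def sumImage {K : Type*} [Field K] {m : ℕ} (S : Set (Fin m → K)) (r : ℕ) : Set (Fin m → K) :=
  {v | ∃ x : Fin r → (Fin m → K), (∀ i, x i ∈ S) ∧ v = ∑ i, x i}

/-- `v` has rank `r` with respect to the cone `S`: `r` is the length of the shortest decomposition
of `v` as a sum of elements of `S`. -/
def HasRank {K : Type*} [Field K] {m : ℕ} (S : Set (Fin m → K)) (v : Fin m → K) (r : ℕ) : Prop :=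
  IsLeast {k : ℕ | v ∈ sumImage S k} r

/-- Zariski open subsets of the affine space `K ^ m`: complements of zero sets of polynomials. -/
def IsZariskiOpen {K : Type*} [Field K] {m : ℕ} (U : Set (Fin m → K)) : Prop :=
  ∃ J : Ideal (MvPolynomial (Fin m) K), U = (MvPolynomial.zeroLocus K J)ᶜ

/-- `r` is a generic rank with respect to the cone `S`: the vectors of rank `r` contain a nonempty
Zariski open set. -/
def IsGenericRank {K : Type*} [Field K] {m : ℕ} (S : Set (Fin m → K)) (r : ℕ) : Prop :=
  ∃ U : Set (Fin m → K), IsZariskiOpen U ∧ U.Nonempty ∧ ∀ v ∈ U, HasRank S v r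

/-- `r` is a typical rank with respect to the real cone `S`: the vectors of rank `r` contain a
nonempty set that is open in the Euclidean topology. -/
def IsTypicalRank {m : ℕ} (S : Set (Fin m → ℝ)) (r : ℕ) : Prop :=
  ∃ U : Set (Fin m → ℝ), IsOpen U ∧ U.Nonempty ∧ ∀ v ∈ U, HasRank S v r

/-- Basic semialgebraic sets: given by finitely many real polynomial equations `f = 0` and
inequalities `g > 0`. -/
def IsBasicSemialgebraic {m : ℕ} (B : Set (Fin m → ℝ)) : Prop :=
  ∃ E P : Finset (MvPolynomial (Fin m) ℝ),
    B = {v | (∀ f ∈ E, MvPolynomial.eval v f = 0) ∧ ∀ g ∈ P, 0 < MvPolynomial.eval v g}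

/-- Semialgebraic sets: finite unions of basic semialgebraic sets. -/
def IsSemialgebraic {m : ℕ} (S : Set (Fin m → ℝ)) : Prop :=
  ∃ 𝓑 : Set (Set (Fin m → ℝ)), 𝓑.Finite ∧ (∀ B ∈ 𝓑, IsBasicSemialgebraic B) ∧ S = ⋃₀ 𝓑

/-!
Let `C` be the real cone over `X` and `C_ℂ` the complex one, and let `rgen` be the least `r` for
which the sums of `r` points of `C` are Zariski dense; it exists because `C` spans the whole space
(`ProjVariety.exists_sumImage_eq_univ`).

Since the real points are dense in `X`, a complex polynomial that vanishes on `C` vanishes on `C_ℂ`.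
Replacing the summands one at a time, the same holds for sums of `r` points
(`ProjVariety.eval_eq_zero_of_mem_sumImage_complex`), so that real and complex sums become Zariski
dense for the same `r`.  For fewer summands both lie in a common hypersurface, which may be taken to
be a cone because the sums are stable under scaling (`ProjVariety.exists_form_of_not_dense`).

Over `ℂ`, a dense sum image contains the complement of a hypersurface by Chevalley's theorem and the
Nullstellensatz (`exists_ne_zero_forall_mem_sumImage`); this gives the generic rank.  Over `ℝ`, the
sum image is semialgebraic by the Tarski–Seidenberg theorem, and a Zariski dense semialgebraic set
has interior points, because one of its basic pieces involves no equation
(`IsSemialgebraic.exists_isOpen_subset`); this gives the smallest typical rank.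

Tarski–Seidenberg is proved in a back-and-forth form that avoids explicit formulas.  Two families of
real polynomials in one variable have the same sign diagram if an order isomorphism of `ℝ` matches
their signs.  Given finitely many polynomials over a ring `A`, the signs of finitely many elements of
`A` determine the sign diagram of their specializations along `A →+* ℝ`
(`exists_determinesDiagram`).  As in the Cohen–Hörmander algorithm, a polynomial `p` of top degree is
traded for its derivative and its pseudo-remainders by the other polynomials: these fix the intervals
on which `p` is monotone and the signs of `p` at their end points, hence the position of the zeros
of `p` (`exists_matchesSigns_insert`, `CoMonotoneOff.exists_orderIso`).
-/

/-! ### Order isomorphisms of the real line matching finite configurations -/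

lemma Finset.exists_lt_forall_le (W : Finset ℝ) (x : ℝ) : ∃ u < x, ∀ w ∈ W, w < x → w ≤ u := by
  induction W using Finset.induction_on with
  | empty => exact ⟨x - 1, by linarith, by simp⟩
  | insert w W _ ih =>
    obtain ⟨u, hu, h⟩ := ih
    by_cases hw : w < x
    · refine ⟨max u w, max_lt hu hw, fun v hv hvx => ?_⟩
      rcases Finset.mem_insert.1 hv with rfl | hv
      · exact le_max_right _ _
      · exact (h v hv hvx).trans (le_max_left _ _)
    · refine ⟨u, hu, fun v hv hvx => ?_⟩
      rcases Finset.mem_insert.1 hv with rfl | hv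
      · exact absurd hvx hw
      · exact h v hv hvx

lemma Finset.exists_gt_forall_ge (W : Finset ℝ) (x : ℝ) : ∃ u > x, ∀ w ∈ W, x < w → u ≤ w := by
  obtain ⟨u, hu, h⟩ := (W.image Neg.neg).exists_lt_forall_le (-x)
  refine ⟨-u, by linarith, fun w hw hxw => ?_⟩
  have := h (-w) (Finset.mem_image_of_mem _ hw) (by linarith)
  linarith

/-- For `u < x ≤ y < v` there is an order isomorphism of `ℝ` that moves `x` to `y` and is the
identity outside `(u, v)`. -/
lemma exists_orderIso_apply_eq_of_le {u x y v : ℝ} (hux : u < x) (hxy : x ≤ y) (hyv : y < v) :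
    ∃ σ : ℝ ≃o ℝ, σ x = y ∧ (∀ w ≤ u, σ w = w) ∧ ∀ w, v ≤ w → σ w = w := by
  -- `l₁` is the line through `(u, u)` and `(x, y)`, `l₂` the one through `(x, y)` and `(v, v)`
  set c₁ : ℝ := (y - u) / (x - u) with hc₁
  set c₂ : ℝ := (v - y) / (v - x) with hc₂
  have h₁ : 1 ≤ c₁ := by rw [hc₁, one_le_div (by linarith)]; linarith
  have h₂ : c₂ ≤ 1 := by rw [hc₂, div_le_one (by linarith)]; linarith
  have h₂' : 0 < c₂ := div_pos (by linarith) (by linarith)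
  let l₁ : ℝ → ℝ := fun t => u + c₁ * (t - u)
  let l₂ : ℝ → ℝ := fun t => v - c₂ * (v - t)
  let F : ℝ → ℝ := fun t => max t (min (l₁ t) (l₂ t))
  have hlow : ∀ w ≤ u, F w = w := fun w hw => by
    refine max_eq_left ((min_le_left _ _).trans ?_)
    change u + c₁ * (w - u) ≤ w
    nlinarith
  have hhigh : ∀ w, v ≤ w → F w = w := fun w hw => by
    refine max_eq_left ((min_le_right _ _).trans ?_)
    change v - c₂ * (v - w) ≤ w
    nlinarith
  have hmono : StrictMono F := fun s t hst => by
    have e₁ : l₁ s < l₁ t := by change u + c₁ * (s - u) < u + c₁ * (t - u); nlinarith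
    have e₂ : l₂ s < l₂ t := by change v - c₂ * (v - s) < v - c₂ * (v - t); nlinarith
    exact max_lt_max hst (min_lt_min e₁ e₂)
  have hcont : Continuous F := by fun_prop
  have hsurj : Function.Surjective F := by
    refine hcont.surjective (Filter.tendsto_atTop_mono (fun t => le_max_left _ _) Filter.tendsto_id)
      (Filter.Tendsto.congr' ?_ Filter.tendsto_id)
    filter_upwards [Filter.eventually_le_atBot u] with w hw
    exact (hlow w hw).symm
  refine ⟨hmono.orderIsoOfSurjective F hsurj, ?_, hlow, hhigh⟩
  change max x (min (l₁ x) (l₂ x)) = y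
  have e₁ : l₁ x = y := by
    change u + (y - u) / (x - u) * (x - u) = y
    rw [div_mul_cancel₀ _ (by linarith)]; ring
  have e₂ : l₂ x = y := by
    change v - (v - y) / (v - x) * (v - x) = y
    rw [div_mul_cancel₀ _ (by linarith)]; ring
  rw [e₁, e₂, min_self, max_eq_right hxy]

/-- If no point of the finite set `W` lies between `x` and `y`, then some order isomorphism of `ℝ`
moves `x` to `y` and fixes `W`. -/
lemma exists_orderIso_apply_eq (W : Finset ℝ) {x y : ℝ} (h : ∀ w ∈ W, w ∉ Set.uIcc x y) :
    ∃ σ : ℝ ≃o ℝ, σ x = y ∧ ∀ w ∈ W, σ w = w := by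
  wlog hxy : x ≤ y generalizing x y
  · obtain ⟨σ, hσ, hW⟩ := this (by rwa [Set.uIcc_comm]) (le_of_not_ge hxy)
    refine ⟨σ.symm, by rw [← hσ, σ.symm_apply_apply], fun w hw => ?_⟩
    rw [OrderIso.symm_apply_eq, hW w hw]
  obtain ⟨u, hu, huW⟩ := W.exists_lt_forall_le x
  obtain ⟨v, hv, hvW⟩ := W.exists_gt_forall_ge y
  obtain ⟨σ, hσ, hlow, hhigh⟩ := exists_orderIso_apply_eq_of_le hu hxy hv
  refine ⟨σ, hσ, fun w hw => ?_⟩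
  have := h w hw
  rw [Set.uIcc_of_le hxy, Set.mem_Icc, not_and_or, not_le, not_le] at this
  rcases this with hwx | hyw
  · exact hlow w (huW w hw hwx)
  · exact hhigh w (hvW w hw hyw)

/-- If `Z` separates the points of `R`, and `ρ` leaves each of them on the same side of every point
of `Z`, then `ρ` on `R` extends to an order isomorphism of `ℝ` that fixes `Z`. -/
lemma exists_orderIso_extending (Z R : Finset ℝ) (ρ : ℝ → ℝ)
    (hsep : ∀ η ∈ R, ∀ η' ∈ R, η < η' → ∃ z ∈ Z, η < z ∧ z < η')
    (hρ : ∀ η ∈ R, ∀ z ∈ Z, (z < η ↔ z < ρ η) ∧ (η < z ↔ ρ η < z)) :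
    ∃ ψ : ℝ ≃o ℝ, (∀ z ∈ Z, ψ z = z) ∧ ∀ η ∈ R, ψ η = ρ η := by
  induction R using Finset.induction_on with
  | empty => exact ⟨OrderIso.refl ℝ, by simp, by simp⟩
  | insert η R hη ih =>
    obtain ⟨ψ, hψZ, hψR⟩ := ih
      (fun a ha b hb => hsep a (Finset.mem_insert_of_mem ha) b (Finset.mem_insert_of_mem hb))
      (fun a ha => hρ a (Finset.mem_insert_of_mem ha))
    have hη0 := hρ η (Finset.mem_insert_self _ _)
    by_cases hηZ : η ∈ Z
    · refine ⟨ψ, hψZ, fun a ha => ?_⟩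
      rcases Finset.mem_insert.1 ha with rfl | ha
      · rw [hψZ _ hηZ]
        have := hη0 _ hηZ
        simp only [lt_self_iff_false, false_iff, not_lt] at this
        exact le_antisymm this.2 this.1
      · exact hψR a ha
    have hlt : ∀ z ∈ Z, (z < η ↔ z < ψ η) ∧ (η < z ↔ ψ η < z) := fun z hz => by
      constructor
      · conv_rhs => rw [← hψZ z hz]
        exact ψ.lt_iff_lt.symm
      · conv_rhs => rw [← hψZ z hz]
        exact ψ.lt_iff_lt.symm
    have hside : ∀ z ∈ Z, z < η ∧ z < ψ η ∧ z < ρ η ∨ η < z ∧ ψ η < z ∧ ρ η < z := fun z hz => by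
      rcases lt_or_gt_of_ne (fun h : z = η => hηZ (h ▸ hz)) with h | h
      · exact Or.inl ⟨h, (hlt z hz).1.1 h, (hη0 z hz).1.1 h⟩
      · exact Or.inr ⟨h, (hlt z hz).2.1 h, (hη0 z hz).2.1 h⟩
    obtain ⟨σ, hσ, hσW⟩ := exists_orderIso_apply_eq (Z ∪ R.image ρ) (x := ψ η) (y := ρ η) (by
      intro w hw hwI
      rw [Set.mem_uIcc] at hwI
      rcases Finset.mem_union.1 hw with hw | hw
      · rcases hside w hw with h | h <;> rcases hwI with h' | h' <;> linarith
      · obtain ⟨a, ha, rfl⟩ := Finset.mem_image.1 hw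
        have ha' := Finset.mem_insert_of_mem (a := a) (b := η) ha
        rcases lt_or_gt_of_ne (fun h : a = η => hη (h ▸ ha)) with h | h
        · obtain ⟨z, hz, h1, h2⟩ := hsep a ha' η (Finset.mem_insert_self _ _) h
          have := (hρ a ha' z hz).2.1 h1
          rcases hside z hz with h | h <;> rcases hwI with h' | h' <;> linarith
        · obtain ⟨z, hz, h1, h2⟩ := hsep η (Finset.mem_insert_self _ _) a ha' h
          have := (hρ a ha' z hz).1.1 h2
          rcases hside z hz with h | h <;> rcases hwI with h' | h' <;> linarith)
    refine ⟨ψ.trans σ, fun z hz => ?_, fun a ha => ?_⟩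
    · rw [OrderIso.trans_apply, hψZ z hz, hσW z (Finset.mem_union_left _ hz)]
    · rw [OrderIso.trans_apply]
      rcases Finset.mem_insert.1 ha with rfl | ha
      · exact hσ
      · rw [hψR a ha, hσW _ (Finset.mem_union_right _ (Finset.mem_image_of_mem _ ha))]

/-! ### Sign diagrams of piecewise monotone functions -/

/-- `f` and `g` are strictly monotone, in the same direction, on every interval whose interior
contains no point of `Z`. -/
def CoMonotoneOff (f g : ℝ → ℝ) (Z : Finset ℝ) : Prop :=
  ∀ x y : ℝ, x < y → (∀ z ∈ Z, z ≤ x ∨ y ≤ z) →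
    (StrictMonoOn f (Set.Icc x y) ∧ StrictMonoOn g (Set.Icc x y)) ∨
    (StrictAntiOn f (Set.Icc x y) ∧ StrictAntiOn g (Set.Icc x y))

lemma CoMonotoneOff.mono {f g : ℝ → ℝ} {Z Z' : Finset ℝ} (h : CoMonotoneOff f g Z) (hZ : Z ⊆ Z') :
    CoMonotoneOff f g Z' :=
  fun x y hxy hz => h x y hxy fun z hz' => hz z (hZ hz')

lemma Finset.exists_consecutive (Z : Finset ℝ) {lo hi t : ℝ} (hlo : lo ∈ Z) (hhi : hi ∈ Z)
    (h1 : lo < t) (h2 : t < hi) (ht : t ∉ Z) :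
    ∃ a ∈ Z, ∃ b ∈ Z, a < t ∧ t < b ∧ ∀ z ∈ Z, z ≤ a ∨ b ≤ z := by
  have hA : (Z.filter (· < t)).Nonempty := ⟨lo, by simp [hlo, h1]⟩
  have hB : (Z.filter (t < ·)).Nonempty := ⟨hi, by simp [hhi, h2]⟩
  have ha := Finset.mem_filter.1 (Finset.max'_mem _ hA)
  have hb := Finset.mem_filter.1 (Finset.min'_mem _ hB)
  refine ⟨_, ha.1, _, hb.1, ha.2, hb.2, fun z hz => ?_⟩
  rcases lt_or_gt_of_ne (fun h : z = t => ht (h ▸ hz)) with h | h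
  · exact Or.inl (Finset.le_max' _ _ (Finset.mem_filter.2 ⟨hz, h⟩))
  · exact Or.inr (Finset.min'_le _ _ (Finset.mem_filter.2 ⟨hz, h⟩))

lemma sign_eq_of_forall_ne_zero {f : ℝ → ℝ} (hf : Continuous f) {x y : ℝ} (hxy : x ≤ y)
    (h : ∀ t ∈ Set.Icc x y, f t ≠ 0) : SignType.sign (f x) = SignType.sign (f y) := by
  rcases lt_or_gt_of_ne (h x ⟨le_rfl, hxy⟩) with hx | hx <;>
    rcases lt_or_gt_of_ne (h y ⟨hxy, le_rfl⟩) with hy | hy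
  · rw [sign_neg hx, sign_neg hy]
  · obtain ⟨t, ht, h0⟩ := intermediate_value_Icc hxy hf.continuousOn ⟨hx.le, hy.le⟩
    exact absurd h0 (h t ht)
  · obtain ⟨t, ht, h0⟩ := intermediate_value_Icc' hxy hf.continuousOn ⟨hy.le, hx.le⟩
    exact absurd h0 (h t ht)
  · rw [sign_pos hx, sign_pos hy]

lemma exists_zero_Ioo {f : ℝ → ℝ} (hf : Continuous f) {x y : ℝ} (hxy : x ≤ y)
    (h : f x < 0 ∧ 0 < f y ∨ f y < 0 ∧ 0 < f x) : ∃ t, x < t ∧ t < y ∧ f t = 0 := by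
  rcases h with h | h
  · obtain ⟨t, ht, h0⟩ := intermediate_value_Ioo hxy hf.continuousOn h
    exact ⟨t, ht.1, ht.2, h0⟩
  · obtain ⟨t, ht, h0⟩ := intermediate_value_Ioo' hxy hf.continuousOn h
    exact ⟨t, ht.1, ht.2, h0⟩

lemma neg_iff_of_sign_eq {a b : ℝ} (h : SignType.sign a = SignType.sign b) : a < 0 ↔ b < 0 := by
  rw [← sign_eq_neg_one_iff, h, sign_eq_neg_one_iff]

lemma pos_iff_of_sign_eq {a b : ℝ} (h : SignType.sign a = SignType.sign b) : 0 < a ↔ 0 < b := by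
  rw [← sign_eq_one_iff, h, sign_eq_one_iff]

lemma eq_zero_iff_of_sign_eq {a b : ℝ} (h : SignType.sign a = SignType.sign b) :
    a = 0 ↔ b = 0 := by
  rw [← sign_eq_zero_iff, h, sign_eq_zero_iff]

lemma sign_eq_of_pos_of_neg {a b : ℝ} (hp : 0 < a → 0 < b) (hn : a < 0 → b < 0)
    (h0 : a = 0 → b = 0) : SignType.sign a = SignType.sign b := by
  rcases lt_trichotomy a 0 with h | h | h
  · rw [sign_neg h, sign_neg (hn h)]
  · rw [h, h0 h]
  · rw [sign_pos h, sign_pos (hp h)]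

/-- Between neighbouring points `a`, `b` of the exceptional set, `g ∘ ψ` is positive wherever `f` is,
provided that `ψ` carries zeros to zeros. -/
lemma pos_of_pos_of_comonotone {f g : ℝ → ℝ} (hf : Continuous f) {ψ : ℝ ≃o ℝ} {a b t : ℝ}
    (ha : ψ a = a) (hb : ψ b = b) (hsa : SignType.sign (f a) = SignType.sign (g a))
    (hsb : SignType.sign (f b) = SignType.sign (g b))
    (hmono : (StrictMonoOn f (Set.Icc a b) ∧ StrictMonoOn g (Set.Icc a b)) ∨
      (StrictAntiOn f (Set.Icc a b) ∧ StrictAntiOn g (Set.Icc a b)))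
    (hψ : ∀ η, a < η → η < b → f η = 0 → g (ψ η) = 0) (hat : a < t) (htb : t < b)
    (ht : 0 < f t) : 0 < g (ψ t) := by
  have hmem : ∀ {s}, a < s → s < b → ψ s ∈ Set.Icc a b := fun {s} h1 h2 =>
    ⟨by rw [← ha]; exact ψ.monotone h1.le, by rw [← hb]; exact ψ.monotone h2.le⟩
  have hat' : a < ψ t := by conv_lhs => rw [← ha]
                            exact ψ.strictMono hat
  have htb' : ψ t < b := by conv_rhs => rw [← hb]
                            exact ψ.strictMono htb
  have hab : a ≤ b := (hat.trans htb).le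
  rcases hmono with ⟨_, hg⟩ | ⟨_, hg⟩
  · rcases lt_or_ge (f a) 0 with h | h
    · obtain ⟨η, h1, h2, h0⟩ := exists_zero_Ioo hf hat.le (Or.inl ⟨h, ht⟩)
      rw [← hψ η h1 (h2.trans htb) h0]
      exact hg (hmem h1 (h2.trans htb)) (hmem hat htb) (ψ.strictMono h2)
    · have : 0 ≤ g a := not_lt.1 fun h' => h.not_gt ((neg_iff_of_sign_eq hsa).2 h')
      exact this.trans_lt (hg ⟨le_rfl, hab⟩ (hmem hat htb) hat')
  · rcases lt_or_ge (f b) 0 with h | h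
    · obtain ⟨η, h1, h2, h0⟩ := exists_zero_Ioo hf htb.le (Or.inr ⟨h, ht⟩)
      rw [← hψ η (hat.trans h1) h2 h0]
      exact hg (hmem hat htb) (hmem (hat.trans h1) h2) (ψ.strictMono h1)
    · have : 0 ≤ g b := not_lt.1 fun h' => h.not_gt ((neg_iff_of_sign_eq hsb).2 h')
      exact this.trans_lt (hg (hmem hat htb) ⟨hab, le_rfl⟩ htb')

/-- Two continuous functions that are monotone in the same direction off a finite set `Z`, and have
the same signs on `Z`, have the same sign diagram.  Here `Z` is assumed to reach beyond all zeros
on both sides. -/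
lemma CoMonotoneOff.exists_orderIso_of_bounds {f g : ℝ → ℝ} {Z : Finset ℝ}
    (h : CoMonotoneOff f g Z) (hf : Continuous f) (hg : Continuous g)
    (hfin : {t | f t = 0}.Finite)
    (hZ : ∀ z ∈ Z, SignType.sign (f z) = SignType.sign (g z)) {lo hi : ℝ} (hlo : lo ∈ Z)
    (hhi : hi ∈ Z) (hlo' : ∀ t ≤ lo, f t ≠ 0 ∧ g t ≠ 0) (hhi' : ∀ t, hi ≤ t → f t ≠ 0 ∧ g t ≠ 0) :
    ∃ ψ : ℝ ≃o ℝ, (∀ z ∈ Z, ψ z = z) ∧ ∀ t, SignType.sign (f t) = SignType.sign (g (ψ t)) := by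
  classical
  have hconsec : ∀ t, t ∉ Z → lo < t → t < hi → _ := fun t ht h1 h2 =>
    Z.exists_consecutive hlo hhi h1 h2 ht
  -- every zero of `f` has a partner among the zeros of `g`
  have hpartner : ∀ η, f η = 0 → ∃ y, g y = 0 ∧ ∀ z ∈ Z, (z < η ↔ z < y) ∧ (η < z ↔ y < z) := by
    intro η hη
    by_cases hηZ : η ∈ Z
    · exact ⟨η, (eq_zero_iff_of_sign_eq (hZ η hηZ)).1 hη, fun _ _ => ⟨Iff.rfl, Iff.rfl⟩⟩
    have h1 : lo < η := not_le.1 fun h => (hlo' η h).1 hη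
    have h2 : η < hi := not_le.1 fun h => (hhi' η h).1 hη
    obtain ⟨a, ha, b, hb, haη, hηb, hab⟩ := hconsec η hηZ h1 h2
    have hab' := (haη.trans hηb).le
    have hy : ∃ y, a < y ∧ y < b ∧ g y = 0 := by
      apply exists_zero_Ioo hg hab'
      rcases h a b (haη.trans hηb) hab with ⟨hm, _⟩ | ⟨hm, _⟩
      · left
        rw [← neg_iff_of_sign_eq (hZ a ha), ← pos_iff_of_sign_eq (hZ b hb), ← hη]
        exact ⟨hm ⟨le_rfl, hab'⟩ ⟨haη.le, hηb.le⟩ haη, hm ⟨haη.le, hηb.le⟩ ⟨hab', le_rfl⟩ hηb⟩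
      · right
        rw [← neg_iff_of_sign_eq (hZ b hb), ← pos_iff_of_sign_eq (hZ a ha), ← hη]
        exact ⟨hm ⟨haη.le, hηb.le⟩ ⟨hab', le_rfl⟩ hηb, hm ⟨le_rfl, hab'⟩ ⟨haη.le, hηb.le⟩ haη⟩
    obtain ⟨y, hay, hyb, hy⟩ := hy
    refine ⟨y, hy, fun z hz => ?_⟩
    rcases hab z hz with hz | hz
    · exact ⟨by constructor <;> intro <;> linarith, by constructor <;> intro <;> linarith⟩
    · exact ⟨by constructor <;> intro <;> linarith, by constructor <;> intro <;> linarith⟩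
  choose! ρ hρ0 hρ using hpartner
  obtain ⟨ψ, hψZ, hψR⟩ := exists_orderIso_extending Z hfin.toFinset ρ (by
      intro η hη η' hη' hlt
      by_contra! hcon
      rw [Set.Finite.mem_toFinset, Set.mem_ofPred_eq] at hη hη'
      rcases h η η' hlt (fun z hz => (le_or_gt z η).imp_right (hcon z hz)) with ⟨hm, _⟩ | ⟨hm, _⟩
      · have := hm ⟨le_rfl, hlt.le⟩ ⟨hlt.le, le_rfl⟩ hlt
        rw [hη, hη'] at this
        exact this.false
      · have := hm ⟨le_rfl, hlt.le⟩ ⟨hlt.le, le_rfl⟩ hlt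
        rw [hη, hη'] at this
        exact this.false)
    (fun η hη => hρ η (by simpa using hη))
  have hψ0 : ∀ η, f η = 0 → g (ψ η) = 0 := fun η hη => by
    rw [hψR η (by simpa using hη)]; exact hρ0 η hη
  refine ⟨ψ, hψZ, fun t => ?_⟩
  by_cases htZ : t ∈ Z
  · rw [hψZ t htZ, hZ t htZ]
  rcases le_or_gt t lo with h1 | h1
  · have h1' : ψ t ≤ lo := by rw [← hψZ lo hlo]; exact ψ.monotone h1
    rw [sign_eq_of_forall_ne_zero hf h1 fun s hs => (hlo' s hs.2).1,
      sign_eq_of_forall_ne_zero hg h1' fun s hs => (hlo' s hs.2).2, hZ lo hlo]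
  rcases le_or_gt hi t with h2 | h2
  · have h2' : hi ≤ ψ t := by rw [← hψZ hi hhi]; exact ψ.monotone h2
    rw [← sign_eq_of_forall_ne_zero hf h2 fun s hs => (hhi' s hs.1).1,
      ← sign_eq_of_forall_ne_zero hg h2' fun s hs => (hhi' s hs.1).2, hZ hi hhi]
  obtain ⟨a, ha, b, hb, hat, htb, hab⟩ := hconsec t htZ h1 h2
  have hm := h a b (hat.trans htb) hab
  refine sign_eq_of_pos_of_neg (fun ht => ?_) (fun ht => ?_) (hψ0 t)
  · exact pos_of_pos_of_comonotone hf (hψZ a ha) (hψZ b hb) (hZ a ha) (hZ b hb) hm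
      (fun η _ _ => hψ0 η) hat htb ht
  · refine neg_pos.1 (pos_of_pos_of_comonotone (f := fun t => -f t) (g := fun t => -g t)
      hf.neg (hψZ a ha) (hψZ b hb) ?_ ?_ ?_ (fun η _ _ hη => ?_) hat htb (neg_pos.2 ht))
    · rw [Left.sign_neg, Left.sign_neg, hZ a ha]
    · rw [Left.sign_neg, Left.sign_neg, hZ b hb]
    · rcases hm with hm | hm
      · exact Or.inr ⟨hm.1.neg, hm.2.neg⟩
      · exact Or.inl ⟨hm.1.neg, hm.2.neg⟩
    · rw [hψ0 η (neg_eq_zero.1 hη), neg_zero]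

/-- Two continuous functions that are monotone in the same direction off a finite set `Z`, are
unbounded at `±∞`, and have the same signs on `Z`, have the same sign diagram. -/
lemma CoMonotoneOff.exists_orderIso {f g : ℝ → ℝ} {Z : Finset ℝ}
    (h : CoMonotoneOff f g Z) (hf : Continuous f) (hg : Continuous g)
    (hfin : {t | f t = 0}.Finite)
    (hZ : ∀ z ∈ Z, SignType.sign (f z) = SignType.sign (g z))
    (hft : Filter.Tendsto (fun t => |f t|) Filter.atTop Filter.atTop)
    (hgt : Filter.Tendsto (fun t => |g t|) Filter.atTop Filter.atTop)
    (hfb : Filter.Tendsto (fun t => |f t|) Filter.atBot Filter.atTop)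
    (hgb : Filter.Tendsto (fun t => |g t|) Filter.atBot Filter.atTop) :
    ∃ ψ : ℝ ≃o ℝ, (∀ z ∈ Z, ψ z = z) ∧ ∀ t, SignType.sign (f t) = SignType.sign (g (ψ t)) := by
  classical
  -- far out both functions have a constant sign, the same by comonotonicity: add end points to `Z`
  obtain ⟨M, hM⟩ := Z.bddAbove
  obtain ⟨m, hm⟩ := Z.bddBelow
  obtain ⟨hi, hi1, hi2⟩ := ((Filter.eventually_gt_atTop M).and
    (Filter.eventually_forall_ge_atTop.2
      ((hft.eventually_gt_atTop |f M|).and (hgt.eventually_gt_atTop |g M|)))).exists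
  obtain ⟨lo, lo1, lo2⟩ := ((Filter.eventually_lt_atBot m).and
    (Filter.eventually_forall_le_atBot.2
      ((hfb.eventually_gt_atTop |f m|).and (hgb.eventually_gt_atTop |g m|)))).exists
  have hsub : Z ⊆ insert lo (insert hi Z) := by grind
  refine ((h.mono hsub).exists_orderIso_of_bounds hf hg hfin ?_ (Finset.mem_insert_self _ _)
    (Finset.mem_insert_of_mem (Finset.mem_insert_self _ _))
    (fun t ht => ⟨fun h0 => ?_, fun h0 => ?_⟩)
    (fun t ht => ⟨fun h0 => ?_, fun h0 => ?_⟩)).imp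
    fun ψ hψ => ⟨fun z hz => hψ.1 z (hsub hz), hψ.2⟩
  · intro z hz
    rcases Finset.mem_insert.1 hz with rfl | hz
    · obtain ⟨e1, e2⟩ := lo2 z le_rfl
      have hz' : ∀ w ∈ Z, w ≤ z ∨ m ≤ w := fun w hw => Or.inr (hm hw)
      rcases h z m lo1 hz' with ⟨k1, k2⟩ | ⟨k1, k2⟩ <;>
      · have d1 := k1 ⟨le_rfl, lo1.le⟩ ⟨lo1.le, le_rfl⟩ lo1
        have d2 := k2 ⟨le_rfl, lo1.le⟩ ⟨lo1.le, le_rfl⟩ lo1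
        first
        | rw [sign_neg (by grind), sign_neg (by grind)]
        | rw [sign_pos (by grind), sign_pos (by grind)]
    rcases Finset.mem_insert.1 hz with rfl | hz
    · obtain ⟨e1, e2⟩ := hi2 z le_rfl
      have hz' : ∀ w ∈ Z, w ≤ M ∨ z ≤ w := fun w hw => Or.inl (hM hw)
      rcases h M z hi1 hz' with ⟨k1, k2⟩ | ⟨k1, k2⟩ <;>
      · have d1 := k1 ⟨le_rfl, hi1.le⟩ ⟨hi1.le, le_rfl⟩ hi1
        have d2 := k2 ⟨le_rfl, hi1.le⟩ ⟨hi1.le, le_rfl⟩ hi1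
        first
        | rw [sign_neg (by grind), sign_neg (by grind)]
        | rw [sign_pos (by grind), sign_pos (by grind)]
    · exact hZ z hz
  · have := (lo2 t ht).1; rw [h0, abs_zero] at this; exact this.not_ge (abs_nonneg _)
  · have := (lo2 t ht).2; rw [h0, abs_zero] at this; exact this.not_ge (abs_nonneg _)
  · have := (hi2 t ht).1; rw [h0, abs_zero] at this; exact this.not_ge (abs_nonneg _)
  · have := (hi2 t ht).2; rw [h0, abs_zero] at this; exact this.not_ge (abs_nonneg _)

/-! ### Tarski–Seidenberg: eliminating one variable -/

open Polynomial in
/-- Pseudo-division of `p` by `q`: after multiplying `p` by a power of the leading coefficient `c`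
of `q`, division with remainder needs no denominators. -/
lemma Polynomial.exists_pseudo_divMod {A : Type*} [CommRing A] (p q : A[X]) {k : ℕ} (hk : 0 < k)
    (hq : q.natDegree ≤ k) :
    ∃ r h : A[X], ∃ N : ℕ, r.natDegree < k ∧ C (q.coeff k ^ N) * p = h * q + r := by
  induction hd : p.natDegree using Nat.strong_induction_on generalizing p with
  | _ d ih =>
    rcases lt_or_ge d k with hdk | hdk
    · exact ⟨p, 0, 0, hd ▸ hdk, by simp⟩
    set c := q.coeff k
    set p₁ := C c * p - C (p.coeff d) * (X ^ (d - k) * q) with hp₁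
    have hdeg : p₁.natDegree ≤ d - 1 := by
      rw [natDegree_le_iff_coeff_eq_zero]
      intro N hN
      rw [hp₁, coeff_sub, coeff_C_mul, coeff_C_mul, coeff_X_pow_mul', if_pos (by omega)]
      rcases eq_or_lt_of_le (show d ≤ N by omega) with rfl | hN'
      · rw [show d - (d - k) = k by omega]; ring
      · rw [coeff_eq_zero_of_natDegree_lt (by omega),
          coeff_eq_zero_of_natDegree_lt (p := q) (by omega)]; ring
    obtain ⟨r, h, N, hr, e⟩ := ih _ (by omega) p₁ rfl
    refine ⟨r, h + C (c ^ N) * (C (p.coeff d) * X ^ (d - k)), N + 1, hr, ?_⟩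
    have : C (c ^ (N + 1)) * p = C (c ^ N) * p₁ +
        C (c ^ N) * (C (p.coeff d) * X ^ (d - k)) * q := by
      rw [hp₁, pow_succ, C_mul]; ring
    rw [this, e]; ring

open Polynomial in
lemma Polynomial.map_modByMonic_X_pow {A : Type*} [CommRing A] (m : A →+* ℝ) (q : A[X]) {k : ℕ}
    (hk : (q.map m).natDegree ≤ k) : (q %ₘ X ^ (k + 1)).map m = q.map m := by
  rw [map_modByMonic _ (monic_X_pow _), Polynomial.map_pow, map_X,
    modByMonic_eq_self_iff (monic_X_pow _), degree_X_pow]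
  exact lt_of_le_of_lt degree_le_natDegree (by exact_mod_cast Nat.lt_succ_of_le hk)

/-- An order isomorphism that fixes the zeros of `F` does not change the sign of `F`. -/
lemma sign_apply_eq_of_fixes {F : ℝ → ℝ} (hF : Continuous F) {Z : Finset ℝ}
    (hZ : ∀ t, F t = 0 → t ∈ Z) {ψ : ℝ ≃o ℝ} (hψ : ∀ z ∈ Z, ψ z = z) (t : ℝ) :
    SignType.sign (F t) = SignType.sign (F (ψ t)) := by
  by_cases ht : t ∈ Z
  · rw [hψ t ht]
  rcases le_total t (ψ t) with h | h
  · refine sign_eq_of_forall_ne_zero hF h fun s hs h0 => ?_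
    have hs' := hZ s h0
    have : t < s := lt_of_le_of_ne hs.1 fun h => ht (h ▸ hs')
    exact (ψ.strictMono this).not_ge (by rw [hψ s hs']; exact hs.2)
  · refine (sign_eq_of_forall_ne_zero hF h fun s hs h0 => ?_).symm
    have hs' := hZ s h0
    have : s < t := lt_of_le_of_ne hs.2 fun h => ht (h ▸ hs')
    exact (ψ.strictMono this).not_ge (by rw [hψ s hs']; exact hs.1)

open Polynomial in
lemma Polynomial.coMonotoneOff {P Q : ℝ[X]} {φ : ℝ ≃o ℝ} {Z : Finset ℝ}
    (hder : ∀ t, SignType.sign (P.derivative.eval t) = SignType.sign (Q.derivative.eval (φ t)))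
    (hZ : ∀ t, P.derivative.eval t = 0 → t ∈ Z) :
    CoMonotoneOff (fun t => P.eval t) (fun t => Q.eval (φ t)) Z := by
  intro x y hxy hz
  have hne : ∀ t ∈ Set.Ioo x y, P.derivative.eval t ≠ 0 := fun t ht h0 => by
    rcases hz t (hZ t h0) with h | h
    · exact ht.1.not_ge h
    · exact ht.2.not_ge h
  have hconst : ∀ s ∈ Set.Ioo x y, ∀ t ∈ Set.Ioo x y, s ≤ t →
      SignType.sign (P.derivative.eval s) = SignType.sign (P.derivative.eval t) :=
    fun s hs t ht hst => sign_eq_of_forall_ne_zero (f := fun t => P.derivative.eval t)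
      P.derivative.continuous hst
      fun u hu => hne u ⟨hs.1.trans_le hu.1, hu.2.trans_lt ht.2⟩
  have hw : (x + y) / 2 ∈ Set.Ioo x y := ⟨by linarith, by linarith⟩
  have hconst' : ∀ t ∈ Set.Ioo x y, SignType.sign (P.derivative.eval ((x + y) / 2)) =
      SignType.sign (P.derivative.eval t) := fun t ht =>
    (le_total ((x + y) / 2) t).elim (hconst _ hw t ht) fun h => (hconst t ht _ hw h).symm
  have hmem : ∀ s ∈ Set.Icc x y, φ s ∈ Set.Icc (φ x) (φ y) := fun s hs =>
    ⟨φ.monotone hs.1, φ.monotone hs.2⟩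
  have hQ : ∀ s ∈ Set.Ioo (φ x) (φ y), SignType.sign (P.derivative.eval ((x + y) / 2)) =
      SignType.sign (Q.derivative.eval s) := fun s hs => by
    rw [hconst' (φ.symm s) ⟨φ.lt_symm_apply.2 hs.1, φ.symm_apply_lt.2 hs.2⟩, hder,
      φ.apply_symm_apply]
  rcases lt_or_gt_of_ne (hne _ hw) with h | h
  · right
    refine ⟨strictAntiOn_of_deriv_neg (convex_Icc x y) P.continuous.continuousOn ?_, ?_⟩
    · intro t ht
      rw [interior_Icc] at ht
      rw [Polynomial.deriv]
      exact (neg_iff_of_sign_eq (hconst' t ht)).1 h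
    · have := strictAntiOn_of_deriv_neg (convex_Icc (φ x) (φ y)) Q.continuous.continuousOn (by
        intro t ht
        rw [interior_Icc] at ht
        rw [Polynomial.deriv]
        exact (neg_iff_of_sign_eq (hQ t ht)).1 h)
      exact fun s hs t ht hst => this (hmem s hs) (hmem t ht) (φ.strictMono hst)
  · left
    refine ⟨strictMonoOn_of_deriv_pos (convex_Icc x y) P.continuous.continuousOn ?_, ?_⟩
    · intro t ht
      rw [interior_Icc] at ht
      rw [Polynomial.deriv]
      exact (pos_iff_of_sign_eq (hconst' t ht)).1 h
    · have := strictMonoOn_of_deriv_pos (convex_Icc (φ x) (φ y)) Q.continuous.continuousOn (by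
        intro t ht
        rw [interior_Icc] at ht
        rw [Polynomial.deriv]
        exact (pos_iff_of_sign_eq (hQ t ht)).1 h)
      exact fun s hs t ht hst => this (hmem s hs) (hmem t ht) (φ.strictMono hst)

open Polynomial in
/-- `φ` matches the sign of `p` specialized along `m` with its sign specialized along `m'`. -/
def MatchesSigns {A : Type*} [CommRing A] (m m' : A →+* ℝ) (φ : ℝ ≃o ℝ) (p : A[X]) : Prop :=
  ∀ t, SignType.sign ((p.map m).eval t) = SignType.sign ((p.map m').eval (φ t))

open Polynomial in
/-- At a zero of `q`, the sign of `p` is read off from the pseudo-remainder `r` of `p` by `q`.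
Reducing `q` modulo `X ^ (k + 1)` discards the coefficients that vanish under `m`. -/
lemma MatchesSigns.sign_eval_eq_of_root {A : Type*} [CommRing A] {m m' : A →+* ℝ} {φ : ℝ ≃o ℝ}
    {p q r h : A[X]} {N : ℕ} {z : ℝ}
    (hcoeff : ∀ i, SignType.sign (m (q.coeff i)) = SignType.sign (m' (q.coeff i)))
    (hq : MatchesSigns m m' φ q) (hr : MatchesSigns m m' φ r) (hq0 : q.map m ≠ 0)
    (hz : (q.map m).eval z = 0)
    (e : C ((q %ₘ X ^ ((q.map m).natDegree + 1)).coeff (q.map m).natDegree ^ N) * p =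
      h * (q %ₘ X ^ ((q.map m).natDegree + 1)) + r) :
    SignType.sign ((p.map m).eval z) = SignType.sign ((p.map m').eval (φ z)) := by
  set k := (q.map m).natDegree with hk
  have hdeg' : (q.map m').natDegree ≤ k := by
    rw [natDegree_le_iff_coeff_eq_zero]
    intro N hN
    rw [coeff_map, ← eq_zero_iff_of_sign_eq (hcoeff N), ← coeff_map]
    exact coeff_eq_zero_of_natDegree_lt hN
  have hm := map_modByMonic_X_pow m q hk.ge
  have hm' := map_modByMonic_X_pow m' q hdeg'
  have hz' : (q.map m').eval (φ z) = 0 := (eq_zero_iff_of_sign_eq (hq z)).1 hz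
  have e₁ : m (q.coeff k) ^ N * (p.map m).eval z = (r.map m).eval z := by
    have := congrArg (fun s => (s.map m).eval z) e
    simp only [Polynomial.map_mul, Polynomial.map_add, hm, eval_mul, eval_add, hz, map_C, eval_C,
      mul_zero, zero_add, map_pow, Polynomial.map_pow, eval_pow] at this
    rw [← this, show m (q.coeff k) = _ by rw [← coeff_map, ← hm, coeff_map]]
  have e₂ : m' (q.coeff k) ^ N * (p.map m').eval (φ z) = (r.map m').eval (φ z) := by
    have := congrArg (fun s => (s.map m').eval (φ z)) e
    simp only [Polynomial.map_mul, Polynomial.map_add, hm', eval_mul, eval_add, hz', map_C, eval_C,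
      mul_zero, zero_add, map_pow, Polynomial.map_pow, eval_pow] at this
    rw [← this, show m' (q.coeff k) = _ by rw [← coeff_map, ← hm', coeff_map]]
  have hc : m (q.coeff k) ≠ 0 := by
    rw [← coeff_map]
    exact leadingCoeff_ne_zero.2 hq0
  have := hr z
  rw [← e₁, ← e₂, sign_mul, sign_mul, sign_pow, sign_pow, ← hcoeff k] at this
  exact mul_left_cancel₀ (pow_ne_zero _ (sign_ne_zero.2 hc)) this

open Polynomial in
/-- If `φ` matches the signs of the polynomials in `L`, of the derivative of `p`, and of the
pseudo-remainders of `p` by all of these, then it can be modified so as to match the sign of `p`,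
too. -/
lemma exists_matchesSigns_insert {A : Type*} [CommRing A] [DecidableEq A[X]] {m m' : A →+* ℝ}
    {φ : ℝ ≃o ℝ} {L : Finset A[X]} {p : A[X]} (rm : A[X] → ℕ → A[X])
    (hrm : ∀ q k, 0 < k → ∃ (h : A[X]) (N : ℕ),
      C ((q %ₘ X ^ (k + 1)).coeff k ^ N) * p = h * (q %ₘ X ^ (k + 1)) + rm q k)
    (hcoeff : ∀ q ∈ insert p.derivative L, ∀ i,
      SignType.sign (m (q.coeff i)) = SignType.sign (m' (q.coeff i)))
    (hφ : ∀ q ∈ insert p.derivative L, MatchesSigns m m' φ q)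
    (hφr : ∀ q ∈ insert p.derivative L, ∀ k, 0 < k → k ≤ q.natDegree →
      MatchesSigns m m' φ (rm q k))
    (hp : p.derivative.map m ≠ 0) (hp' : p.derivative.map m' ≠ 0) :
    ∃ ψ : ℝ ≃o ℝ, ∀ q ∈ insert p L, MatchesSigns m m' ψ q := by
  set Z : Finset ℝ := (insert p.derivative L).biUnion fun q => (q.map m).roots.toFinset with hZdef
  have hZ : ∀ q ∈ insert p.derivative L, q.map m ≠ 0 → ∀ t, (q.map m).eval t = 0 → t ∈ Z :=
    fun q hq h0 t ht => Finset.mem_biUnion.2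
      ⟨q, hq, Multiset.mem_toFinset.2 ((mem_roots h0).2 ht)⟩
  have hdeg : ∀ {n : A →+* ℝ}, p.derivative.map n ≠ 0 → 0 < (p.map n).degree := fun {n} hn => by
    rw [← natDegree_pos_iff_degree_pos, Nat.pos_iff_ne_zero]
    intro h0
    rw [← derivative_map] at hn
    exact hn (derivative_of_natDegree_zero h0)
  have hder := hφ _ (Finset.mem_insert_self _ _)
  have hco : CoMonotoneOff (fun t => (p.map m).eval t) (fun t => (p.map m').eval (φ t)) Z := by
    refine Polynomial.coMonotoneOff (fun t => ?_) (fun t ht => ?_)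
    · rw [derivative_map, derivative_map]; exact hder t
    · rw [derivative_map] at ht
      exact hZ _ (Finset.mem_insert_self _ _) hp t ht
  obtain ⟨ψ, hψZ, hψ⟩ := hco.exists_orderIso (p.map m).continuous
    ((p.map m').continuous.comp φ.continuous)
    (by
      have h0 : p.map m ≠ 0 := fun h0 => by
        have := hdeg hp
        rw [h0] at this
        simp at this
      refine (p.map m).roots.toFinset.finite_toSet.subset fun t ht => ?_
      exact Multiset.mem_toFinset.2 ((mem_roots h0).2 ht))
    (fun z hz => by
      obtain ⟨q, hq, hz⟩ := Finset.mem_biUnion.1 hz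
      obtain ⟨hq0, hqz⟩ := mem_roots'.1 (Multiset.mem_toFinset.1 hz)
      have hpos : 0 < (q.map m).natDegree :=
        natDegree_pos_iff_degree_pos.2 (degree_pos_of_root hq0 hqz)
      obtain ⟨h, N, e⟩ := hrm q _ hpos
      exact MatchesSigns.sign_eval_eq_of_root (hcoeff q hq) (hφ q hq)
        (hφr q hq _ hpos natDegree_map_le) hq0 hqz e)
    ((p.map m).abs_tendsto_atTop (hdeg hp))
    (((p.map m').abs_tendsto_atTop (hdeg hp')).comp φ.tendsto_atTop)
    ((p.map m).abs_tendsto_atBot (hdeg hp))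
    (((p.map m').abs_tendsto_atBot (hdeg hp')).comp φ.tendsto_atBot)
  refine ⟨ψ.trans φ, fun q hq => ?_⟩
  rcases Finset.mem_insert.1 hq with rfl | hq
  · exact hψ
  · have hq' := Finset.mem_insert_of_mem (b := p.derivative) hq
    intro t
    rw [OrderIso.trans_apply, hφ q hq' t]
    by_cases h0 : q.map m = 0
    · have hz : ∀ s, (q.map m').eval s = 0 := fun s => by
        have := hφ q hq' (φ.symm s)
        rw [φ.apply_symm_apply, h0, eval_zero] at this
        exact (eq_zero_iff_of_sign_eq this).1 rfl
      rw [hz, hz]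
    · exact sign_apply_eq_of_fixes (F := fun t => (q.map m').eval (φ t))
        ((q.map m').continuous.comp φ.continuous)
        (fun s hs => hZ q hq' h0 s ((eq_zero_iff_of_sign_eq (hφ q hq' s)).2 hs)) hψZ t

open Polynomial in
/-- The signs of the elements of `S` determine the sign diagram of the polynomials in `L`. -/
def DeterminesDiagram {A : Type*} [CommRing A] (S : Finset A) (L : Finset A[X]) : Prop :=
  ∀ m m' : A →+* ℝ, (∀ a ∈ S, SignType.sign (m a) = SignType.sign (m' a)) →
    ∃ φ : ℝ ≃o ℝ, ∀ p ∈ L, MatchesSigns m m' φ p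

open Polynomial in
lemma sign_coeff_eq_of_mem_coeffs {A : Type*} [CommRing A] {m m' : A →+* ℝ} {q : A[X]}
    (h : ∀ a ∈ q.coeffs, SignType.sign (m a) = SignType.sign (m' a)) (i : ℕ) :
    SignType.sign (m (q.coeff i)) = SignType.sign (m' (q.coeff i)) := by
  by_cases h0 : q.coeff i = 0
  · simp [h0]
  · exact h _ (coeff_mem_coeffs h0)

open Polynomial in
/-- Tarski–Seidenberg for one variable.  The proof is by induction on a degree bound `d` and, for
given `d`, on the number of polynomials that are allowed to reach it. -/
theorem exists_determinesDiagram {A : Type*} [CommRing A] (L : Finset A[X]) :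
    ∃ S : Finset A, DeterminesDiagram S L := by
  classical
  suffices H : ∀ d : ℕ, ∀ L : Finset A[X], (∀ p ∈ L, p.natDegree ≤ d) →
      ∃ S : Finset A, DeterminesDiagram S L from
    H (L.sup natDegree) L fun p hp => Finset.le_sup (f := natDegree) hp
  intro d
  induction d with
  | zero =>
    intro L hL
    refine ⟨L.image fun p => p.coeff 0, fun m m' h => ⟨OrderIso.refl ℝ, fun p hp t => ?_⟩⟩
    have := h _ (Finset.mem_image_of_mem _ hp)
    rw [eq_C_of_natDegree_le_zero (hL p hp)]
    simpa using this
  | succ d ihd =>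
    -- `H` holds the polynomials of degree up to `d + 1`, replaced one by one
    suffices K : ∀ H : Finset A[X], (∀ p ∈ H, p.natDegree ≤ d + 1) → ∀ L : Finset A[X],
        (∀ p ∈ L, p.natDegree ≤ d) → ∃ S : Finset A, DeterminesDiagram S (H ∪ L) by
      intro L hL
      simpa using K L hL ∅ (by simp)
    intro H
    induction H using Finset.induction_on with
    | empty => intro _ L hL; simpa using ihd L hL
    | insert p H _ ihH =>
      intro hH L hL
      have ihH := ihH fun q hq => hH q (Finset.mem_insert_of_mem hq)
      have hpd := hH p (Finset.mem_insert_self _ _)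
      have hrm : ∀ (q : A[X]) (k : ℕ), ∃ r : A[X], 0 < k → r.natDegree < k ∧
          ∃ (h : A[X]) (N : ℕ), C ((q %ₘ X ^ (k + 1)).coeff k ^ N) * p =
            h * (q %ₘ X ^ (k + 1)) + r := by
        intro q k
        by_cases hk : 0 < k
        · have hle : (q %ₘ X ^ (k + 1)).natDegree ≤ k := by
            rcases subsingleton_or_nontrivial A with hA | hA
            · rw [Subsingleton.elim (q %ₘ X ^ (k + 1)) 0]; simp
            · have := natDegree_modByMonic_lt q (monic_X_pow (k + 1))
                (fun h => by simpa using congrArg natDegree h)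
              rw [natDegree_X_pow] at this
              omega
          obtain ⟨r, h, N, hr, e⟩ := exists_pseudo_divMod p (q %ₘ X ^ (k + 1)) hk hle
          exact ⟨r, fun _ => ⟨hr, h, N, e⟩⟩
        · exact ⟨0, fun h => absurd h hk⟩
      choose rm hrm using hrm
      set L' := H ∪ L
      have hL' : ∀ q ∈ L', q.natDegree ≤ d + 1 := fun q hq =>
        (Finset.mem_union.1 hq).elim (fun h => hH q (Finset.mem_insert_of_mem h))
          fun h => (hL q h).trans (Nat.le_succ d)
      set D := insert p.derivative L'
      have hpder : p.derivative.natDegree ≤ d :=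
        (natDegree_derivative_le p).trans (by omega)
      set rems : Finset A[X] := D.biUnion fun q => (Finset.Icc 1 q.natDegree).image (rm q)
      obtain ⟨S₁, hS₁⟩ := ihH (insert (p - C (p.coeff (d + 1)) * X ^ (d + 1)) L) (by
        intro q hq
        rcases Finset.mem_insert.1 hq with rfl | hq
        · rw [natDegree_le_iff_coeff_eq_zero]
          intro N hN
          rw [coeff_sub, coeff_C_mul, coeff_X_pow]
          rcases eq_or_lt_of_le (Nat.succ_le_of_lt hN) with rfl | hN
          · simp
          · rw [if_neg (by omega), coeff_eq_zero_of_natDegree_lt (by omega)]; simp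
        · exact hL q hq)
      obtain ⟨S₂, hS₂⟩ := ihH (insert p.derivative L ∪ rems) (by
        intro q hq
        rcases Finset.mem_union.1 hq with hq | hq
        · rcases Finset.mem_insert.1 hq with rfl | hq
          · exact hpder
          · exact hL q hq
        · obtain ⟨q', hq', hq⟩ := Finset.mem_biUnion.1 hq
          obtain ⟨k, hk, rfl⟩ := Finset.mem_image.1 hq
          rw [Finset.mem_Icc] at hk
          have h1 := (hrm q' k hk.1).1
          have h2 : q'.natDegree ≤ d + 1 := by
            rcases Finset.mem_insert.1 hq' with rfl | hq'
            · omega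
            · exact hL' q' hq'
          omega)
      refine ⟨insert (p.coeff (d + 1)) (S₁ ∪ S₂ ∪ D.biUnion coeffs), fun m m' hs => ?_⟩
      have hc := hs _ (Finset.mem_insert_self _ _)
      by_cases hc0 : m (p.coeff (d + 1)) = 0
      · -- the top coefficient vanishes, so that `p` specializes to a polynomial of lower degree
        have hc0' := (eq_zero_iff_of_sign_eq hc).1 hc0
        obtain ⟨φ, hφ⟩ := hS₁ m m' fun a ha => hs a (by grind)
        refine ⟨φ, fun q hq => ?_⟩
        by_cases hqp : q = p
        · subst hqp
          have := hφ (q - C (q.coeff (d + 1)) * X ^ (d + 1)) (by grind)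
          intro t
          simpa [hc0, hc0'] using this t
        · exact hφ q (by grind)
      · have hc0' := fun h => hc0 ((eq_zero_iff_of_sign_eq hc).2 h)
        obtain ⟨φ, hφ⟩ := hS₂ m m' fun a ha => hs a (by grind)
        have hder : ∀ {n : A →+* ℝ}, n (p.coeff (d + 1)) ≠ 0 → p.derivative.map n ≠ 0 := by
          intro n hn h0
          have := congrArg (fun s => s.coeff d) h0
          simp only [coeff_map, coeff_derivative, map_mul, coeff_zero, mul_eq_zero] at this
          rcases this with h | h
          · exact hn h
          · simp only [map_add, map_natCast, map_one] at h
            exact absurd h (by positivity)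
        have hD : ∀ q ∈ D, q ∈ H ∪ (insert p.derivative L ∪ rems) := by grind
        obtain ⟨ψ, hψ⟩ := exists_matchesSigns_insert (L := L') (p := p) (φ := φ) (m := m)
          (m' := m') rm (fun q k hk => (hrm q k hk).2)
          (fun q hq => sign_coeff_eq_of_mem_coeffs fun a ha => hs a (by
            refine Finset.mem_insert_of_mem (Finset.mem_union_right _ ?_)
            exact Finset.mem_biUnion.2 ⟨q, hq, ha⟩))
          (fun q hq => hφ q (hD q hq))
          (fun q hq k hk hkq => hφ _ (by
            refine Finset.mem_union_right _ (Finset.mem_union_right _ ?_)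
            exact Finset.mem_biUnion.2 ⟨q, hq, Finset.mem_image_of_mem _
              (Finset.mem_Icc.2 ⟨hk, hkq⟩)⟩))
          (hder hc0) (hder hc0')
        exact ⟨ψ, fun q hq => hψ q (by rwa [Finset.insert_union] at hq)⟩

/-! ### Semialgebraic sets and sum maps -/

lemma MvPolynomial.eval₂_cons_eq_eval_map {k : ℕ} {A : Type*} [CommRing A] (n : A →+* ℝ) (t : ℝ)
    (z : Fin k → ℝ) (p : MvPolynomial (Fin (k + 1)) A) : p.eval₂ n (Fin.cons t z) =
      ((MvPolynomial.finSuccEquiv A k p).map (MvPolynomial.eval₂Hom n z)).eval t := by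
  induction p using MvPolynomial.induction_on with
  | C a => simp [MvPolynomial.finSuccEquiv_apply]
  | add p q hp hq => simp [hp, hq]
  | mul_X p i hp =>
    cases i using Fin.cases <;>
      simp [hp, MvPolynomial.finSuccEquiv_X_zero, MvPolynomial.finSuccEquiv_X_succ]

/-- Tarski–Seidenberg for several variables in back-and-forth form: the signs of finitely many
elements of `A` determine which sign patterns the polynomials in `L` take. -/
theorem exists_finset_forall_exists_sign_eval₂_eq {k : ℕ} {A : Type*} [CommRing A]
    (L : Finset (MvPolynomial (Fin k) A)) : ∃ S : Finset A, ∀ m m' : A →+* ℝ,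
      (∀ a ∈ S, SignType.sign (m a) = SignType.sign (m' a)) → ∀ x : Fin k → ℝ, ∃ x' : Fin k → ℝ,
        ∀ p ∈ L, SignType.sign (p.eval₂ m x) = SignType.sign (p.eval₂ m' x') := by
  classical
  induction k generalizing A with
  | zero =>
    refine ⟨L.image MvPolynomial.constantCoeff, fun m m' h x => ⟨x, fun p hp => ?_⟩⟩
    have := h _ (Finset.mem_image_of_mem _ hp)
    obtain ⟨a, rfl⟩ := MvPolynomial.C_surjective (Fin 0) p
    simpa using this
  | succ k ih =>
    obtain ⟨S₁, hS₁⟩ := exists_determinesDiagram (L.image (MvPolynomial.finSuccEquiv A k))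
    obtain ⟨S, hS⟩ := ih S₁
    refine ⟨S, fun m m' h x => ?_⟩
    obtain ⟨y, hy⟩ := hS m m' h (Fin.tail x)
    obtain ⟨φ, hφ⟩ := hS₁ (MvPolynomial.eval₂Hom m (Fin.tail x)) (MvPolynomial.eval₂Hom m' y) hy
    refine ⟨Fin.cons (φ (x 0)) y, fun p hp => ?_⟩
    have := hφ _ (Finset.mem_image_of_mem _ hp) (x 0)
    rwa [← MvPolynomial.eval₂_cons_eq_eval_map, ← MvPolynomial.eval₂_cons_eq_eval_map,
      Fin.cons_self_tail] at this

/-- Membership in `S` depends only on the signs of finitely many polynomials. -/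
def IsSignDetermined {m : ℕ} (S : Set (Fin m → ℝ)) : Prop :=
  ∃ P : Finset (MvPolynomial (Fin m) ℝ), ∀ v w : Fin m → ℝ,
    (∀ p ∈ P, SignType.sign (p.eval v) = SignType.sign (p.eval w)) → v ∈ S → w ∈ S

lemma IsSignDetermined.isSemialgebraic {m : ℕ} {S : Set (Fin m → ℝ)} (h : IsSignDetermined S) :
    IsSemialgebraic S := by
  classical
  obtain ⟨P, hP⟩ := h
  let cell : (P → SignType) → Set (Fin m → ℝ) := fun s =>
    {v | ∀ p : P, SignType.sign (p.1.eval v) = s p}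
  let sgn : (Fin m → ℝ) → P → SignType := fun v p => SignType.sign (p.1.eval v)
  refine ⟨cell '' (sgn '' S), (Set.toFinite _).image _, ?_, ?_⟩
  · rintro _ ⟨s, -, rfl⟩
    refine ⟨(Finset.univ.filter fun p => s p = 0).image Subtype.val,
      (Finset.univ.filter fun p => s p = 1).image Subtype.val ∪
      (Finset.univ.filter fun p => s p = -1).image fun p => -p.1, ?_⟩
    ext v
    constructor
    · intro hv
      refine ⟨fun f hf => ?_, fun g hg => ?_⟩
      · obtain ⟨p, hp, rfl⟩ := Finset.mem_image.1 hf
        exact sign_eq_zero_iff.1 ((hv p).trans (Finset.mem_filter.1 hp).2)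
      · rcases Finset.mem_union.1 hg with hg | hg
        · obtain ⟨p, hp, rfl⟩ := Finset.mem_image.1 hg
          exact sign_eq_one_iff.1 ((hv p).trans (Finset.mem_filter.1 hp).2)
        · obtain ⟨p, hp, rfl⟩ := Finset.mem_image.1 hg
          rw [map_neg, neg_pos]
          exact sign_eq_neg_one_iff.1 ((hv p).trans (Finset.mem_filter.1 hp).2)
    · rintro ⟨hE, hG⟩ p
      rcases hs : s p with _ | _ | _
      · exact sign_eq_zero_iff.2 (hE p (Finset.mem_image.2 ⟨p, by simpa using hs, rfl⟩))
      · have := hG (-p.1) (Finset.mem_union_right _ (Finset.mem_image.2 ⟨p, by simpa using hs, rfl⟩))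
        rw [map_neg, neg_pos] at this
        exact sign_eq_neg_one_iff.2 this
      · exact sign_eq_one_iff.2 (hG p
          (Finset.mem_union_left _ (Finset.mem_image.2 ⟨p, by simpa using hs, rfl⟩)))
  · ext v
    constructor
    · intro hv
      exact ⟨cell (sgn v), ⟨_, ⟨v, hv, rfl⟩, rfl⟩, fun _ => rfl⟩
    · rintro ⟨_, ⟨_, ⟨w, hw, rfl⟩, rfl⟩, hv⟩
      exact hP w v (fun p hp => (hv ⟨p, hp⟩).symm) hw

/-- A semialgebraic set on which no nonzero polynomial vanishes has interior points: one of its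
basic pieces is defined by strict inequalities alone. -/
lemma IsSemialgebraic.exists_isOpen_subset {m : ℕ} {S : Set (Fin m → ℝ)} (hS : IsSemialgebraic S)
    (hdense : ∀ f : MvPolynomial (Fin m) ℝ, (∀ v ∈ S, f.eval v = 0) → f = 0) :
    ∃ U : Set (Fin m → ℝ), IsOpen U ∧ U.Nonempty ∧ U ⊆ S := by
  classical
  obtain ⟨B, hfin, hB, rfl⟩ := hS
  by_contra! hcon
  have : ∀ b ∈ B, ∃ f : MvPolynomial (Fin m) ℝ, f ≠ 0 ∧ ∀ v ∈ b, f.eval v = 0 := by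
    intro b hb
    obtain ⟨E, P, hEP⟩ := hB b hb
    by_cases hE : ∃ f ∈ E, f ≠ 0
    · obtain ⟨f, hf, hf0⟩ := hE
      exact ⟨f, hf0, fun v hv => by rw [hEP] at hv; exact hv.1 f hf⟩
    · push Not at hE
      refine ⟨1, one_ne_zero, fun v hv => absurd (Set.subset_sUnion_of_mem hb) ?_⟩
      refine hcon b ?_ ⟨v, hv⟩
      have : b = ⋂ g ∈ P, {v | 0 < MvPolynomial.eval v g} := by
        rw [hEP]
        ext v
        simp only [Set.mem_iInter]
        exact ⟨fun h => h.2, fun h => ⟨fun f hf => by rw [hE f hf, map_zero], h⟩⟩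
      rw [this]
      exact isOpen_biInter_finset fun g _ =>
        isOpen_lt continuous_const (MvPolynomial.continuous_eval g)
  choose! f hf0 hf using this
  have := hdense (∏ b ∈ hfin.toFinset, f b) (by
    rintro v ⟨b, hb, hv⟩
    rw [map_prod]
    exact Finset.prod_eq_zero (hfin.mem_toFinset.2 hb) (hf b hb v hv))
  rw [Finset.prod_eq_zero_iff] at this
  obtain ⟨b, hb, h0⟩ := this
  exact hf0 b (hfin.mem_toFinset.1 hb) h0

lemma mem_sumImage_zero {K : Type*} [Field K] {m : ℕ} {S : Set (Fin m → K)} {v : Fin m → K} :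
    v ∈ sumImage S 0 ↔ v = 0 := by
  constructor
  · rintro ⟨x, _, rfl⟩; simp
  · rintro rfl; exact ⟨fun i => i.elim0, fun i => i.elim0, by simp⟩

lemma mem_sumImage_succ {K : Type*} [Field K] {m : ℕ} {S : Set (Fin m → K)} {r : ℕ}
    {v : Fin m → K} : v ∈ sumImage S (r + 1) ↔ ∃ x ∈ S, ∃ w ∈ sumImage S r, v = x + w := by
  constructor
  · rintro ⟨x, hx, rfl⟩
    exact ⟨x 0, hx 0, ∑ i, x (Fin.succ i), ⟨_, fun i => hx _, rfl⟩, Fin.sum_univ_succ x⟩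
  · rintro ⟨x, hx, _, ⟨y, hy, rfl⟩, rfl⟩
    exact ⟨Fin.cons x y, Fin.cases hx hy, by simp [Fin.sum_univ_succ]⟩

lemma sumImage_mono {K : Type*} [Field K] {m : ℕ} {S : Set (Fin m → K)} (h0 : (0 : Fin m → K) ∈ S)
    {r s : ℕ} (hrs : r ≤ s) : sumImage S r ⊆ sumImage S s := by
  induction hrs with
  | refl => exact subset_rfl
  | step _ ih => exact fun v hv => mem_sumImage_succ.2 ⟨0, h0, v, ih hv, (zero_add v).symm⟩

/-- Sums of points of a real algebraic set form a semialgebraic set. -/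
lemma isSignDetermined_sumImage_zeroLocus {m : ℕ} (I : Ideal (MvPolynomial (Fin m) ℝ)) (r : ℕ) :
    IsSignDetermined (sumImage (MvPolynomial.zeroLocus ℝ I) r) := by
  classical
  induction r with
  | zero =>
    refine ⟨Finset.univ.image MvPolynomial.X, fun v w h hv => ?_⟩
    rw [mem_sumImage_zero] at hv ⊢
    funext i
    have := h _ (Finset.mem_image_of_mem _ (Finset.mem_univ i))
    rw [MvPolynomial.eval_X, MvPolynomial.eval_X] at this
    exact (eq_zero_iff_of_sign_eq this).1 (congrFun hv i)
  | succ r ih =>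
    obtain ⟨P, hP⟩ := ih
    obtain ⟨G, hG⟩ := IsNoetherian.noetherian I
    -- in `ℝ[v][x]`: the equations `g(x) = 0`, and the polynomials `p(v - x)`
    let ι : MvPolynomial (Fin m) ℝ →+* MvPolynomial (Fin m) (MvPolynomial (Fin m) ℝ) :=
      MvPolynomial.map MvPolynomial.C
    let δ : MvPolynomial (Fin m) ℝ →ₐ[ℝ] MvPolynomial (Fin m) (MvPolynomial (Fin m) ℝ) :=
      MvPolynomial.aeval fun i => MvPolynomial.C (MvPolynomial.X i) - MvPolynomial.X i
    have hι : ∀ g (v x : Fin m → ℝ), (ι g).eval₂ (MvPolynomial.eval v) x = g.eval x := by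
      intro g v x
      change MvPolynomial.eval₂ _ _ (MvPolynomial.map _ g) = _
      rw [MvPolynomial.eval₂_map]
      have : (MvPolynomial.eval v).comp MvPolynomial.C = RingHom.id ℝ := by ext; simp
      rw [this]
      rfl
    have hδ : ∀ g (v x : Fin m → ℝ), (δ g).eval₂ (MvPolynomial.eval v) x = g.eval (v - x) := by
      intro g v x
      induction g using MvPolynomial.induction_on with
      | C a => simp [δ, MvPolynomial.algebraMap_eq, MvPolynomial.algebraMap_apply]
      | add p q hp hq => rw [map_add, MvPolynomial.eval₂_add, hp, hq, map_add]
      | mul_X p i hp =>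
        rw [map_mul, MvPolynomial.eval₂_mul, hp, map_mul]
        simp [δ]
    obtain ⟨S, hS⟩ := exists_finset_forall_exists_sign_eval₂_eq (G.image ι ∪ P.image δ)
    refine ⟨S, fun v w hvw hv => ?_⟩
    obtain ⟨x, hx, y, hy, rfl⟩ := mem_sumImage_succ.1 hv
    obtain ⟨x', hx'⟩ := hS _ _ hvw x
    refine mem_sumImage_succ.2 ⟨x', ?_, w - x', ?_, by abel⟩
    · rw [← hG] at hx ⊢
      rw [← Ideal.span, MvPolynomial.zeroLocus_span] at hx ⊢
      intro g hg
      have := hx' _ (Finset.mem_union_left _ (Finset.mem_image_of_mem _ hg))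
      rw [hι, hι] at this
      exact (eq_zero_iff_of_sign_eq this).1 (hx g hg)
    · refine hP y _ (fun p hp => ?_) hy
      have := hx' _ (Finset.mem_union_right _ (Finset.mem_image_of_mem _ hp))
      rwa [hδ, hδ, add_sub_cancel_left] at this

/-! ### Real and complex cones -/

lemma MvPolynomial.IsHomogeneous.eval_smul {K : Type*} [Field K] {m d : ℕ}
    {p : MvPolynomial (Fin m) K} (hp : p.IsHomogeneous d) (c : K) (v : Fin m → K) :
    p.eval (c • v) = c ^ d * p.eval v := by
  rw [eval_eq', eval_eq', Finset.mul_sum]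
  refine Finset.sum_congr rfl fun u hu => ?_
  have hdeg : ∑ i, u i = d := by
    have : Finsupp.weight (fun _ => 1) u = d := hp (mem_support_iff.1 hu)
    rwa [← Finsupp.degree_eq_weight_one, Finsupp.degree_eq_sum] at this
  simp only [Pi.smul_apply, smul_eq_mul, mul_pow, Finset.prod_mul_distrib,
    Finset.prod_pow_eq_pow_sum, hdeg]
  ring

lemma MvPolynomial.eval_smul_eq_sum {K : Type*} [Field K] {m : ℕ} (p : MvPolynomial (Fin m) K)
    (c : K) (v : Fin m → K) : p.eval (c • v) =
      ∑ d ∈ Finset.range (p.totalDegree + 1), c ^ d * (p.homogeneousComponent d).eval v := by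
  conv_lhs => rw [← p.sum_homogeneousComponent]
  rw [map_sum]
  refine Finset.sum_congr rfl fun d _ => ?_
  exact (MvPolynomial.homogeneousComponent_isHomogeneous d p).eval_smul c v

/-- If a polynomial vanishes on a set stable under scaling, so do its homogeneous components. -/
lemma MvPolynomial.eval_homogeneousComponent_eq_zero {K : Type*} [Field K] [Infinite K] {m : ℕ}
    {S : Set (Fin m → K)} (hS : ∀ (c : K), ∀ v ∈ S, c • v ∈ S) {p : MvPolynomial (Fin m) K}
    (hp : ∀ v ∈ S, p.eval v = 0) (d : ℕ) : ∀ v ∈ S, (p.homogeneousComponent d).eval v = 0 := by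
  intro v hv
  by_cases hd : d ≤ p.totalDegree
  · let q : Polynomial K := ∑ d ∈ Finset.range (p.totalDegree + 1),
      Polynomial.C ((p.homogeneousComponent d).eval v) * Polynomial.X ^ d
    have hq : q = 0 := Polynomial.funext fun c => by
      have := hp _ (hS c v hv)
      rw [MvPolynomial.eval_smul_eq_sum] at this
      simp only [q, Polynomial.eval_finsetSum, Polynomial.eval_mul, Polynomial.eval_C,
        Polynomial.eval_pow, Polynomial.eval_X, Polynomial.eval_zero]
      rw [← this]
      exact Finset.sum_congr rfl fun _ _ => mul_comm _ _
    have := congrArg (fun q => q.coeff d) hq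
    simpa [q, Polynomial.finsetSum_coeff, Polynomial.coeff_C_mul, Polynomial.coeff_X_pow,
      Nat.lt_succ_iff, hd] using this
  · rw [MvPolynomial.homogeneousComponent_eq_zero _ _ (by omega), map_zero]

namespace ProjVariety

variable {n : ℕ} {X : ProjVariety ℝ n}

lemma smul_mem_cone (X : ProjVariety ℝ n) (c : ℝ) {v : Fin (n + 1) → ℝ} (hv : v ∈ X.cone ℝ) :
    c • v ∈ X.cone ℝ := by
  intro p hp
  change MvPolynomial.eval _ p = 0
  rw [MvPolynomial.eval_smul_eq_sum]
  exact Finset.sum_eq_zero fun d _ => mul_eq_zero_of_right _ (hv _ (X.homogeneous p hp d))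

/-- Density of the real points, for polynomials that need not be homogeneous. -/
lemma mem_ideal_of_forall_eval_eq_zero (hdense : X.RationalPointsDense)
    {p : MvPolynomial (Fin (n + 1)) ℝ} (hp : ∀ v ∈ X.cone ℝ, p.eval v = 0) : p ∈ X.ideal := by
  rw [← p.sum_homogeneousComponent]
  refine Ideal.sum_mem _ fun d _ => hdense d _ (MvPolynomial.homogeneousComponent_isHomogeneous d p)
    fun v hv _ => ?_
  exact MvPolynomial.eval_homogeneousComponent_eq_zero (fun c v hv => X.smul_mem_cone c hv) hp d v hv

lemma zero_mem_cone (hirr : X.IsIrreducible) (K : Type*) [Field K] [Algebra ℝ K] :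
    (0 : Fin (n + 1) → K) ∈ X.cone K := by
  intro p hp
  have h0 := X.homogeneous p hp 0
  rw [MvPolynomial.homogeneousComponent_zero] at h0
  have hc : MvPolynomial.coeff 0 p = 0 := by
    by_contra hc
    refine hirr.1.ne_top (Ideal.eq_top_of_isUnit_mem _ h0 ?_)
    exact (isUnit_iff_ne_zero.2 hc).map MvPolynomial.C
  have : MvPolynomial.aeval (fun _ => (0 : K)) p = algebraMap ℝ K (MvPolynomial.constantCoeff p) :=
    MvPolynomial.aeval_zero' p
  change MvPolynomial.aeval (fun _ => (0 : K)) p = 0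
  rw [this, MvPolynomial.constantCoeff_eq, hc, map_zero]

lemma ofReal_comp_mem_cone {v : Fin (n + 1) → ℝ} (hv : v ∈ X.cone ℝ) :
    (fun i => (v i : ℂ)) ∈ X.cone ℂ := by
  intro p hp
  have h : MvPolynomial.aeval (fun i => algebraMap ℝ ℂ (v i)) p
      = algebraMap ℝ ℂ (MvPolynomial.aeval v p) := by
    rw [← MvPolynomial.aeval_algebraMap_apply]; rfl
  change MvPolynomial.aeval (fun i => algebraMap ℝ ℂ (v i)) p = 0
  rw [h, hv p hp, map_zero]

end ProjVariety

/-- A complex polynomial splits into its real and imaginary parts. -/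
lemma MvPolynomial.exists_eq_map_add_I_mul_map {m : ℕ} (f : MvPolynomial (Fin m) ℂ) :
    ∃ g h : MvPolynomial (Fin m) ℝ,
      f = g.map (algebraMap ℝ ℂ) + C Complex.I * h.map (algebraMap ℝ ℂ) := by
  induction f using MvPolynomial.induction_on with
  | C a =>
    refine ⟨C a.re, C a.im, ?_⟩
    rw [map_C, map_C, ← C_mul, ← C_add]
    congr 1
    rw [mul_comm]
    exact (Complex.re_add_im a).symm
  | add p q hp hq =>
    obtain ⟨g, h, rfl⟩ := hp
    obtain ⟨g', h', rfl⟩ := hq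
    exact ⟨g + g', h + h', by rw [map_add, map_add]; ring⟩
  | mul_X p i hp =>
    obtain ⟨g, h, rfl⟩ := hp
    exact ⟨g * X i, h * X i, by rw [map_mul, map_mul, map_X]; ring⟩

lemma MvPolynomial.eval_ofReal {m : ℕ} (g h : MvPolynomial (Fin m) ℝ) (v : Fin m → ℝ) :
    (g.map (algebraMap ℝ ℂ) + C Complex.I * h.map (algebraMap ℝ ℂ)).eval (fun i => (v i : ℂ)) =
      (g.eval v : ℂ) + Complex.I * (h.eval v : ℂ) := by
  have key : ∀ g : MvPolynomial (Fin m) ℝ,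
      (g.map (algebraMap ℝ ℂ)).eval (fun i => (v i : ℂ)) = (g.eval v : ℂ) := fun g => by
    rw [MvPolynomial.eval_map, ← MvPolynomial.eval₂_id]
    exact (MvPolynomial.eval₂_comp_left (algebraMap ℝ ℂ) (RingHom.id ℝ) v g).symm
  rw [map_add, map_mul, eval_C, key, key]

lemma Complex.re_im_eq_zero_of_add_I_mul {a b : ℝ} (h : (a : ℂ) + Complex.I * b = 0) :
    a = 0 ∧ b = 0 := by
  have h1 := congrArg Complex.re h
  have h2 := congrArg Complex.im h
  simp at h1 h2
  exact ⟨h1, h2⟩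

namespace ProjVariety

variable {n : ℕ} {X : ProjVariety ℝ n}

/-- The real cone is Zariski dense in the complex cone, also over `ℂ`. -/
lemma eval_eq_zero_of_mem_cone_complex (hdense : X.RationalPointsDense)
    {f : MvPolynomial (Fin (n + 1)) ℂ} (hf : ∀ v ∈ X.cone ℝ, f.eval (fun i => (v i : ℂ)) = 0) :
    ∀ v ∈ X.cone ℂ, f.eval v = 0 := by
  obtain ⟨g, h, rfl⟩ := f.exists_eq_map_add_I_mul_map
  have hz := fun v hv => Complex.re_im_eq_zero_of_add_I_mul
    ((MvPolynomial.eval_ofReal g h v).symm.trans (hf v hv))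
  have hg := mem_ideal_of_forall_eval_eq_zero hdense fun v hv => (hz v hv).1
  have hh := mem_ideal_of_forall_eval_eq_zero hdense fun v hv => (hz v hv).2
  intro v hv
  have e1 := hv g hg
  have e2 := hv h hh
  rw [MvPolynomial.aeval_def, ← MvPolynomial.eval_map] at e1 e2
  rw [map_add, map_mul, e1, e2, mul_zero, add_zero]

lemma _root_.MvPolynomial.eval_bind₁_X_add_C {K : Type*} [Field K] {m : ℕ}
    (f : MvPolynomial (Fin m) K) (x y : Fin m → K) :
    (MvPolynomial.bind₁ (fun i => MvPolynomial.X i + MvPolynomial.C (x i)) f).eval y =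
      f.eval (x + y) := by
  induction f using MvPolynomial.induction_on with
  | C a => simp
  | add p q hp hq => rw [map_add, map_add, map_add, hp, hq]
  | mul_X p i hp => rw [map_mul, map_mul, map_mul, hp]; simp [add_comm]

/-- Real sums are Zariski dense among complex sums: the summands are replaced one by one. -/
lemma eval_eq_zero_of_mem_sumImage_complex (hdense : X.RationalPointsDense) (r : ℕ)
    {f : MvPolynomial (Fin (n + 1)) ℂ}
    (hf : ∀ v ∈ sumImage (X.cone ℝ) r, f.eval (fun i => (v i : ℂ)) = 0) :
    ∀ v ∈ sumImage (X.cone ℂ) r, f.eval v = 0 := by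
  induction r generalizing f with
  | zero =>
    intro v hv
    rw [mem_sumImage_zero] at hv
    have := hf 0 (mem_sumImage_zero.2 rfl)
    rw [hv]
    simpa using this
  | succ r ih =>
    let τ : (Fin (n + 1) → ℂ) → MvPolynomial (Fin (n + 1)) ℂ := fun x =>
      MvPolynomial.bind₁ (fun i => MvPolynomial.X i + MvPolynomial.C (x i)) f
    have hτ : ∀ x y, (τ x).eval y = f.eval (x + y) := fun x y => f.eval_bind₁_X_add_C x y
    intro v hv
    obtain ⟨x, hx, w, hw, rfl⟩ := mem_sumImage_succ.1 hv
    rw [← hτ]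
    refine ih (fun s hs => ?_) w hw
    rw [hτ, add_comm x, ← hτ]
    refine eval_eq_zero_of_mem_cone_complex hdense (fun y hy => ?_) x hx
    rw [hτ, ← hf _ (mem_sumImage_succ.2 ⟨y, hy, s, hs, rfl⟩)]
    congr 2
    funext i
    simp [add_comm]

lemma smul_mem_sumImage (X : ProjVariety ℝ n) (r : ℕ) (c : ℝ) {v : Fin (n + 1) → ℝ}
    (hv : v ∈ sumImage (X.cone ℝ) r) : c • v ∈ sumImage (X.cone ℝ) r := by
  obtain ⟨x, hx, rfl⟩ := hv
  exact ⟨fun i => c • x i, fun i => X.smul_mem_cone c (hx i), Finset.smul_sum⟩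

/-- The cone spans the whole space, so that sums of sufficiently many of its elements fill it. -/
lemma exists_sumImage_eq_univ (hnd : X.IsNondegenerate) (hdense : X.RationalPointsDense) :
    ∃ r, ∀ v, v ∈ sumImage (X.cone ℝ) r := by
  have hspan : Submodule.span ℝ (X.cone ℝ) = ⊤ := by
    by_contra hne
    obtain ⟨φ, hφ, hle⟩ := Submodule.exists_le_ker_of_lt_top _ (lt_top_iff_ne_top.2 hne)
    let l : MvPolynomial (Fin (n + 1)) ℝ :=
      ∑ i, MvPolynomial.C (φ (Pi.single i 1)) * MvPolynomial.X i
    have hl : ∀ v, l.eval v = φ v := fun v => by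
      conv_rhs => rw [← Finset.univ_sum_single v]
      simp only [l, map_sum, map_mul, MvPolynomial.eval_C, MvPolynomial.eval_X]
      refine Finset.sum_congr rfl fun i _ => ?_
      conv_rhs => rw [← mul_one (v i), ← smul_eq_mul, Pi.single_smul, map_smul, smul_eq_mul]
      exact mul_comm _ _
    refine hnd l ?_ ?_ (mem_ideal_of_forall_eval_eq_zero hdense fun v hv => ?_)
    · refine MvPolynomial.IsHomogeneous.sum _ _ _ fun i _ => ?_
      simpa using (MvPolynomial.isHomogeneous_C (Fin (n + 1)) (φ (Pi.single i 1))).mul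
        (MvPolynomial.isHomogeneous_X ℝ i)
    · rintro h0
      exact hφ (LinearMap.ext fun v => by rw [← hl, h0]; simp)
    · rw [hl]
      exact hle (Submodule.subset_span hv)
  obtain ⟨x, hx, hxs, -⟩ := Submodule.exists_fun_fin_finrank_span_eq ℝ (X.cone ℝ)
  refine ⟨Module.finrank ℝ (Submodule.span ℝ (X.cone ℝ)), fun v => ?_⟩
  · have : v ∈ Submodule.span ℝ (Set.range x) := by rw [hxs, hspan]; trivial
    obtain ⟨c, hc⟩ := (Submodule.mem_span_range_iff_exists_fun ℝ).1 this
    exact ⟨fun i => c i • x i, fun i => X.smul_mem_cone _ (hx i), hc.symm⟩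

end ProjVariety

/-! ### Dense images of sum maps over the complex numbers -/

/-- A constructible subset of the spectrum of a domain, or its complement, contains a nonempty
basic open set. -/
lemma Topology.IsConstructible.exists_basicOpen_subset {A : Type*} [CommRing A] [IsDomain A]
    {T : Set (PrimeSpectrum A)} (hT : Topology.IsConstructible T) :
    ∃ a : A, a ≠ 0 ∧ ((PrimeSpectrum.basicOpen a : Set (PrimeSpectrum A)) ⊆ T ∨
      (PrimeSpectrum.basicOpen a : Set (PrimeSpectrum A)) ⊆ Tᶜ) := by
  induction hT using Topology.IsConstructible.empty_union_induction with
  | open_retrocompact U hU _ =>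
    rcases U.eq_empty_or_nonempty with rfl | ⟨p, hp⟩
    · exact ⟨1, one_ne_zero, Or.inr (by simp)⟩
    · obtain ⟨_, ⟨a, rfl⟩, hpa, haU⟩ :=
        PrimeSpectrum.isTopologicalBasis_basic_opens.exists_subset_of_mem_open hp hU
      refine ⟨a, ?_, Or.inl haU⟩
      rintro rfl
      simp at hpa
  | union s _ t _ hs ht =>
    obtain ⟨a, ha, h | h⟩ := hs
    · exact ⟨a, ha, Or.inl (h.trans Set.subset_union_left)⟩
    obtain ⟨b, hb, h' | h'⟩ := ht
    · exact ⟨b, hb, Or.inl (h'.trans Set.subset_union_right)⟩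
    refine ⟨a * b, mul_ne_zero ha hb, Or.inr fun p hp => ?_⟩
    rw [PrimeSpectrum.basicOpen_mul] at hp
    rintro (hs | ht)
    · exact h hp.1 hs
    · exact h' hp.2 ht
  | compl s _ hs =>
    obtain ⟨a, ha, h⟩ := hs
    exact ⟨a, ha, by rw [compl_compl]; exact h.symm⟩

/-- Chevalley's theorem for sums of points of an algebraic set: if the sums are Zariski dense, they
contain the complement of a hypersurface. -/
lemma exists_ne_zero_forall_mem_sumImage {K : Type*} [Field K] [IsAlgClosed K] {m : ℕ}
    (I : Ideal (MvPolynomial (Fin m) K)) (r : ℕ)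
    (hdense : ∀ f : MvPolynomial (Fin m) K,
      (∀ v ∈ sumImage (MvPolynomial.zeroLocus K I) r, f.eval v = 0) → f = 0) :
    ∃ a : MvPolynomial (Fin m) K, a ≠ 0 ∧
      ∀ v, a.eval v ≠ 0 → v ∈ sumImage (MvPolynomial.zeroLocus K I) r := by
  -- the ideal of `Z(I) ^ r`, and the comorphism of the sum map
  let J : Ideal (MvPolynomial (Fin r × Fin m) K) :=
    ⨆ i : Fin r, I.map (MvPolynomial.rename (Prod.mk i) :
      MvPolynomial (Fin m) K →ₐ[K] MvPolynomial (Fin r × Fin m) K)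
  let α : MvPolynomial (Fin m) K →ₐ[K] MvPolynomial (Fin r × Fin m) K :=
    MvPolynomial.aeval fun j => ∑ i, MvPolynomial.X (i, j)
  have hα : ∀ f (x : Fin r × Fin m → K), (α f).eval x = f.eval (∑ i, fun j => x (i, j)) := by
    intro f x
    induction f using MvPolynomial.induction_on with
    | C a => simp [α]
    | add p q hp hq => rw [map_add, map_add, map_add, hp, hq]
    | mul_X p i hp => rw [map_mul, map_mul, map_mul, hp]; simp [α]
  have hJ : ∀ x : Fin r × Fin m → K, (∀ p ∈ J, p.eval x = 0) ↔
      ∀ i, (fun j => x (i, j)) ∈ MvPolynomial.zeroLocus K I := by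
    intro x
    have h1 : (∀ p ∈ J, p.eval x = 0) ↔ J ≤ RingHom.ker (MvPolynomial.eval x) := Iff.rfl
    rw [h1, iSup_le_iff]
    refine forall_congr' fun i => ?_
    rw [Ideal.map_le_iff_le_comap]
    refine forall₂_congr fun p _ => ?_
    rw [Ideal.mem_comap, RingHom.mem_ker]
    change (MvPolynomial.eval x) (MvPolynomial.rename _ p) = 0 ↔ MvPolynomial.eval _ p = 0
    rw [MvPolynomial.eval_rename]
    rfl
  have hfp : α.toRingHom.FinitePresentation := by
    refine RingHom.FinitePresentation.of_finiteType.1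
      (RingHom.FiniteType.of_comp_finiteType (f := algebraMap K (MvPolynomial (Fin m) K)) ?_)
    have : α.toRingHom.comp (algebraMap K _) = algebraMap K _ := α.comp_algebraMap
    rw [this, RingHom.finiteType_algebraMap]
    infer_instance
  have hclosed : Topology.IsConstructible
      (PrimeSpectrum.zeroLocus (J : Set (MvPolynomial (Fin r × Fin m) K))) := by
    obtain ⟨G, hG⟩ := IsNoetherian.noetherian J
    rw [← hG, ← Ideal.span, PrimeSpectrum.zeroLocus_span, ← Topology.isConstructible_compl]
    exact (PrimeSpectrum.isRetrocompact_zeroLocus_compl G.finite_toSet).isConstructible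
      (PrimeSpectrum.isClosed_zeroLocus _).isOpen_compl
  obtain ⟨a, ha, h⟩ :=
    (PrimeSpectrum.isConstructible_comap_image hfp hclosed).exists_basicOpen_subset
  have hpt : ∀ {σ : Type} (x : σ → K), (RingHom.ker (MvPolynomial.eval x)).IsPrime := fun x =>
    RingHom.ker_isPrime _
  rcases h with h | h
  · refine ⟨a, ha, fun v hv => ?_⟩
    obtain ⟨P, hPJ, hP⟩ := @h ⟨RingHom.ker (MvPolynomial.eval v), hpt v⟩ hv
    obtain ⟨M, hM, hPM⟩ := Ideal.exists_le_maximal P.asIdeal P.2.ne_top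
    obtain ⟨x, rfl⟩ := MvPolynomial.isMaximal_iff_eq_vanishingIdeal_singleton.1 hM
    have hx : ∀ p ∈ P.asIdeal, p.eval x = 0 := fun p hp =>
      (MvPolynomial.mem_vanishingIdeal_singleton_iff x p).1 (hPM hp)
    refine ⟨fun i j => x (i, j), (hJ x).1 fun p hp => hx p (hPJ hp), ?_⟩
    funext j
    have hmem : MvPolynomial.X j - MvPolynomial.C (v j) ∈
        RingHom.ker (MvPolynomial.eval v) := by simp [RingHom.mem_ker]
    have hP' : (PrimeSpectrum.comap α.toRingHom P).asIdeal = RingHom.ker (MvPolynomial.eval v) :=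
      congrArg PrimeSpectrum.asIdeal hP
    rw [← hP'] at hmem
    have := hx _ hmem
    change (α _).eval x = 0 at this
    rw [hα] at this
    simp only [map_sub, MvPolynomial.eval_X, MvPolynomial.eval_C, sub_eq_zero] at this
    exact this.symm
  · refine absurd (hdense a fun v hv => ?_) ha
    obtain ⟨x, hx, rfl⟩ := hv
    by_contra hav
    refine @h ⟨RingHom.ker (MvPolynomial.eval (∑ i, x i)), hpt _⟩ hav ?_
    let y : Fin r × Fin m → K := fun q => x q.1 q.2
    refine ⟨⟨RingHom.ker (MvPolynomial.eval y), hpt _⟩, fun p hp => (hJ y).2 hx p hp, ?_⟩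
    ext p
    change (α p).eval y = 0 ↔ p.eval _ = 0
    rw [hα]

/-! ### Generic and typical ranks -/

/-- If sums of `r` points contain the complement of a hypersurface, and shorter sums lie in one,
then `r` is a generic rank. -/
lemma isGenericRank_of_ne_zero {K : Type*} [Field K] [Infinite K] {m r : ℕ} {S : Set (Fin m → K)}
    {a f : MvPolynomial (Fin m) K} (ha : a ≠ 0) (hf : f ≠ 0)
    (hr : ∀ v, a.eval v ≠ 0 → v ∈ sumImage S r)
    (hlt : ∀ s < r, ∀ v ∈ sumImage S s, f.eval v = 0) : IsGenericRank S r := by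
  refine ⟨(MvPolynomial.zeroLocus K (Ideal.span {a * f}))ᶜ, ⟨_, rfl⟩, ?_, fun v hv => ?_⟩
  · by_contra hne
    rw [Set.not_nonempty_iff_eq_empty, Set.compl_empty_iff] at hne
    refine mul_ne_zero ha hf (MvPolynomial.funext fun v => ?_)
    have : v ∈ MvPolynomial.zeroLocus K (Ideal.span {a * f}) := hne ▸ Set.mem_univ v
    rw [map_zero]
    exact this _ (Ideal.mem_span_singleton_self _)
  · have hv' : (a * f).eval v ≠ 0 := fun h => hv (by
      rw [MvPolynomial.zeroLocus_span]
      rintro _ rfl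
      exact h)
    rw [map_mul] at hv'
    refine ⟨hr v (left_ne_zero_of_mul hv'), fun s hs => ?_⟩
    by_contra! hlt'
    exact right_ne_zero_of_mul hv' (hlt s hlt' v hs)

lemma IsGenericRank.unique {K : Type*} [Field K] [Infinite K] {m r s : ℕ} {S : Set (Fin m → K)}
    (hr : IsGenericRank S r) (hs : IsGenericRank S s) : r = s := by
  have key : ∀ {U : Set (Fin m → K)}, IsZariskiOpen U → U.Nonempty →
      ∃ p : MvPolynomial (Fin m) K, p ≠ 0 ∧ ∀ v, p.eval v ≠ 0 → v ∈ U := by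
    rintro _ ⟨J, rfl⟩ ⟨v, hv⟩
    obtain ⟨p, hp, hpv⟩ : ∃ p ∈ J, MvPolynomial.aeval v p ≠ 0 := by
      by_contra! h
      exact hv h
    exact ⟨p, fun h => hpv (by rw [h, map_zero]), fun w hw hw' => hw (hw' p hp)⟩
  obtain ⟨U, hU, hU0, hUr⟩ := hr
  obtain ⟨V, hV, hV0, hVs⟩ := hs
  obtain ⟨p, hp, hpU⟩ := key hU hU0
  obtain ⟨q, hq, hqV⟩ := key hV hV0
  obtain ⟨v, hv⟩ : ∃ v, (p * q).eval v ≠ 0 := by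
    by_contra! h
    exact mul_ne_zero hp hq (MvPolynomial.funext fun v => by rw [h, map_zero])
  rw [map_mul] at hv
  exact (hUr v (hpU v (left_ne_zero_of_mul hv))).unique (hVs v (hqV v (right_ne_zero_of_mul hv)))

/-- A polynomial that vanishes on a nonempty Euclidean open set is zero. -/
lemma MvPolynomial.exists_mem_eval_ne_zero {m : ℕ} {U : Set (Fin m → ℝ)} (hU : IsOpen U)
    (hne : U.Nonempty) {f : MvPolynomial (Fin m) ℝ} (hf : f ≠ 0) : ∃ v ∈ U, f.eval v ≠ 0 := by
  by_contra! h
  obtain ⟨u, hu⟩ := hne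
  obtain ⟨ε, hε, hball⟩ := Metric.isOpen_iff.1 hU u hu
  refine hf (MvPolynomial.funext_set (fun i => Metric.ball (u i) ε) (fun i => ?_) fun v hv => ?_)
  · rw [Real.ball_eq_Ioo]
    exact Set.Ioo_infinite (by linarith)
  · rw [map_zero]
    refine h v (hball ?_)
    rw [ball_pi _ hε]
    exact hv

lemma ProjVariety.cone_complex_eq {n : ℕ} (X : ProjVariety ℝ n) : X.cone ℂ =
    MvPolynomial.zeroLocus ℂ (X.ideal.map (MvPolynomial.map (algebraMap ℝ ℂ))) := by
  ext v
  change (∀ p ∈ X.ideal, MvPolynomial.aeval v p = 0) ↔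
    X.ideal.map (MvPolynomial.map (algebraMap ℝ ℂ)) ≤ RingHom.ker (MvPolynomial.eval v)
  rw [Ideal.map_le_iff_le_comap]
  refine forall₂_congr fun p _ => ?_
  rw [Ideal.mem_comap, RingHom.mem_ker, MvPolynomial.eval_map, MvPolynomial.aeval_def]

/-- A set of real points that is Zariski dense over `ℝ` is Zariski dense over `ℂ`. -/
lemma MvPolynomial.eq_zero_of_forall_eval_ofReal {m : ℕ} {S : Set (Fin m → ℝ)}
    (hS : ∀ f : MvPolynomial (Fin m) ℝ, (∀ v ∈ S, f.eval v = 0) → f = 0)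
    {f : MvPolynomial (Fin m) ℂ} (hf : ∀ v ∈ S, f.eval (fun i => (v i : ℂ)) = 0) : f = 0 := by
  obtain ⟨g, h, rfl⟩ := f.exists_eq_map_add_I_mul_map
  have hz := fun v hv => Complex.re_im_eq_zero_of_add_I_mul
    ((MvPolynomial.eval_ofReal g h v).symm.trans (hf v hv))
  rw [hS g fun v hv => (hz v hv).1, hS h fun v hv => (hz v hv).2]
  simp

lemma ofReal_mem_sumImage {n : ℕ} {X : ProjVariety ℝ n} {r : ℕ} {v : Fin (n + 1) → ℝ}
    (hv : v ∈ sumImage (X.cone ℝ) r) : (fun i => (v i : ℂ)) ∈ sumImage (X.cone ℂ) r := by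
  obtain ⟨x, hx, rfl⟩ := hv
  refine ⟨fun i j => x i j, fun i => ProjVariety.ofReal_comp_mem_cone (hx i), ?_⟩
  funext j
  simp

/-- If sums of `r` real points of the cone are not Zariski dense, a form of positive degree vanishes
on them, and hence on the sums of `r` complex points. -/
lemma ProjVariety.exists_form_of_not_dense {n : ℕ} {X : ProjVariety ℝ n}
    (hdense : X.RationalPointsDense) {r : ℕ} {g : MvPolynomial (Fin (n + 1)) ℝ} (hg : g ≠ 0)
    (hgr : ∀ v ∈ sumImage (X.cone ℝ) r, g.eval v = 0) :
    ∃ (d : ℕ) (f : MvPolynomial (Fin (n + 1)) ℝ), 0 < d ∧ f ≠ 0 ∧ f.IsHomogeneous d ∧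
      (∀ v ∈ sumImage (X.cone ℂ) r, MvPolynomial.aeval v f = 0) ∧
      ∀ v ∈ sumImage (X.cone ℝ) r, f.eval v = 0 := by
  obtain ⟨d, hd⟩ : ∃ d, g.homogeneousComponent d ≠ 0 := by
    by_contra! h
    exact hg (by rw [← g.sum_homogeneousComponent]; exact Finset.sum_eq_zero fun d _ => h d)
  have hreal : ∀ v ∈ sumImage (X.cone ℝ) r,
      (g.homogeneousComponent d * MvPolynomial.X 0).eval v = 0 := fun v hv => by
    rw [map_mul, MvPolynomial.eval_homogeneousComponent_eq_zero
      (fun c v hv => X.smul_mem_sumImage r c hv) hgr d v hv, zero_mul]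
  -- the factor `X 0` makes the degree positive
  refine ⟨d + 1, g.homogeneousComponent d * MvPolynomial.X 0, d.succ_pos,
    mul_ne_zero hd (MvPolynomial.X_ne_zero 0),
    (MvPolynomial.homogeneousComponent_isHomogeneous d g).mul (MvPolynomial.isHomogeneous_X ℝ 0),
    fun v hv => ?_, hreal⟩
  rw [MvPolynomial.aeval_def, ← MvPolynomial.eval_map]
  refine ProjVariety.eval_eq_zero_of_mem_sumImage_complex hdense r (fun w hw => ?_) v hv
  have := MvPolynomial.eval_ofReal (g.homogeneousComponent d * MvPolynomial.X 0) 0 w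
  rw [hreal w hw] at this
  simpa using this

theorem theorem2 (n : ℕ) (X : ProjVariety ℝ n) (hirr : X.IsIrreducible)
    (hnd : X.IsNondegenerate) (hdense : X.RationalPointsDense) :
    ∃ rgen : ℕ,
      -- `rgen` is the generic rank (existence and uniqueness) of the complexification
      (∀ r : ℕ, IsGenericRank (X.cone ℂ) r ↔ r = rgen) ∧
      -- the minimum typical real rank exists and equals `rgen`
      IsLeast {r : ℕ | IsTypicalRank (X.cone ℝ) r} rgen ∧
      -- the vectors of lower rank, complex or real, lie in a hypersurface defined over `ℝ`
      (∃ (d : ℕ) (f : MvPolynomial (Fin (n + 1)) ℝ), 0 < d ∧ f ≠ 0 ∧ f.IsHomogeneous d ∧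
        (∀ (v : Fin (n + 1) → ℂ) (r : ℕ), r < rgen → HasRank (X.cone ℂ) v r →
          MvPolynomial.aeval v f = 0) ∧
        (∀ (v : Fin (n + 1) → ℝ) (r : ℕ), r < rgen → HasRank (X.cone ℝ) v r →
          MvPolynomial.eval v f = 0)) ∧
      -- the image of the sum map is semialgebraic and contains a nonempty Euclidean open set
      IsSemialgebraic (sumImage (X.cone ℝ) rgen) ∧
      ∃ U : Set (Fin (n + 1) → ℝ), IsOpen U ∧ U.Nonempty ∧ U ⊆ sumImage (X.cone ℝ) rgen := by
  classical
  -- `rgen` is the least number of summands for which the real sums are Zariski dense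
  have hex : ∃ r, ∀ f : MvPolynomial (Fin (n + 1)) ℝ,
      (∀ v ∈ sumImage (X.cone ℝ) r, f.eval v = 0) → f = 0 := by
    obtain ⟨r, hr⟩ := ProjVariety.exists_sumImage_eq_univ hnd hdense
    exact ⟨r, fun f hf => MvPolynomial.funext fun v => by rw [hf v (hr v), map_zero]⟩
  obtain ⟨rgen, hgen, hmin⟩ : ∃ r, (∀ f : MvPolynomial (Fin (n + 1)) ℝ,
      (∀ v ∈ sumImage (X.cone ℝ) r, f.eval v = 0) → f = 0) ∧ ∀ s < r,
      ¬ ∀ f : MvPolynomial (Fin (n + 1)) ℝ, (∀ v ∈ sumImage (X.cone ℝ) s, f.eval v = 0) → f = 0 :=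
    ⟨Nat.find hex, Nat.find_spec hex, fun s hs => Nat.find_min hex hs⟩
  have hpos : 0 < rgen := by
    rw [Nat.pos_iff_ne_zero]
    rintro rfl
    refine MvPolynomial.X_ne_zero (R := ℝ) (0 : Fin (n + 1)) (hgen _ fun v hv => ?_)
    rw [mem_sumImage_zero.1 hv]
    simp
  obtain ⟨d, f, hd, hf0, hfh, hfC, hfR⟩ : ∃ (d : ℕ) (f : MvPolynomial (Fin (n + 1)) ℝ),
      0 < d ∧ f ≠ 0 ∧ f.IsHomogeneous d ∧
      (∀ r < rgen, ∀ v ∈ sumImage (X.cone ℂ) r, MvPolynomial.aeval v f = 0) ∧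
      ∀ r < rgen, ∀ v ∈ sumImage (X.cone ℝ) r, f.eval v = 0 := by
    have := hmin (rgen - 1) (by omega)
    push Not at this
    obtain ⟨g, hg, hg0⟩ := this
    obtain ⟨d, f, h1, h2, h3, h4, h5⟩ := ProjVariety.exists_form_of_not_dense hdense hg0 hg
    exact ⟨d, f, h1, h2, h3,
      fun r hr v hv => h4 v (sumImage_mono (ProjVariety.zero_mem_cone hirr ℂ) (by omega) hv),
      fun r hr v hv => h5 v (sumImage_mono (ProjVariety.zero_mem_cone hirr ℝ) (by omega) hv)⟩
  have hsemi := (isSignDetermined_sumImage_zeroLocus X.ideal rgen).isSemialgebraic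
  obtain ⟨U, hU, hUne, hUsub⟩ := hsemi.exists_isOpen_subset hgen
  refine ⟨rgen, fun r => ?_, ⟨?_, ?_⟩, ⟨d, f, hd, hf0, hfh, fun v r hr hv => hfC r hr v hv.1,
    fun v r hr hv => hfR r hr v hv.1⟩, hsemi, U, hU, hUne, hUsub⟩
  · have hgenC : IsGenericRank (X.cone ℂ) rgen := by
      obtain ⟨a, ha, har⟩ := exists_ne_zero_forall_mem_sumImage
        (X.ideal.map (MvPolynomial.map (algebraMap ℝ ℂ))) rgen (fun g hg =>
          MvPolynomial.eq_zero_of_forall_eval_ofReal hgen fun v hv =>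
            hg _ (X.cone_complex_eq ▸ ofReal_mem_sumImage hv))
      rw [← X.cone_complex_eq] at har
      have hfC0 : f.map (algebraMap ℝ ℂ) ≠ 0 := fun h =>
        hf0 (MvPolynomial.map_injective _ (algebraMap ℝ ℂ).injective (by rw [h, map_zero]))
      refine isGenericRank_of_ne_zero ha hfC0 har fun s hs v hv => ?_
      rw [MvPolynomial.eval_map, ← MvPolynomial.aeval_def]
      exact hfC s hs v hv
    exact ⟨fun h => h.unique hgenC, fun h => h ▸ hgenC⟩
  · refine ⟨U ∩ {v | f.eval v ≠ 0}, hU.inter ?_, ?_, ?_⟩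
    · exact isOpen_ne_fun (MvPolynomial.continuous_eval f) continuous_const
    · exact MvPolynomial.exists_mem_eval_ne_zero hU hUne hf0
    · rintro v ⟨hv, hfv⟩
      refine ⟨hUsub hv, fun s hs => ?_⟩
      by_contra! hlt
      exact hfv (hfR s hlt v hs)
  · rintro r ⟨V, hV, hVne, hVr⟩
    by_contra! hlt
    obtain ⟨v, hv, hfv⟩ := MvPolynomial.exists_mem_eval_ne_zero hV hVne hf0
    exact hfv (hfR r hlt v (hVr v hv).1)
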